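/- Let $\Sigma$ be a compact connected Riemann surface with a smooth Riemannian metric $g$ compatible with its complex structure (locally $g=e^{2\rho}(dx_1^2+dx_2^2)$ in holomorphic coordinates $x_1+ix_2$), with area measure $d\mu_g$ and area $|\Sigma|$. Let $L\to\Sigma$ be a smooth complex line bundle with smooth Hermitian metric, of degree $N\ge 0$, where the degree is $\frac1{2\pi}\int_\Sigma B\,d\mu_g$ for any smooth $S^1$ connection on $L$ with curvature $2$-form $-iB\,d\mu_g$. Fix a smooth $S^1$ connection $\nabla$ on $L$ of constant curvature, i.e. with curvature $2$-form $-ib\,d\mu_g$, $b\in\mathbb R$ constant. Let $H^1(L)$ be the completion of the smooth sections of $L$ in the norm $(\int_\Sigma|\Phi|^2+|\nabla\Phi|^2\,d\mu_g)^{1/2}$, and $H^1(\Omega^1)$ the completion of the smooth real $1$-forms in the norm $(\|\mathbf A\|_{L^2}^2+\|d\mathbf A\|_{L^2}^2+\|\delta\mathbf A\|_{L^2}^2)^{1/2}$. For $(\mathbf A,\Phi)\in H^1(\Omega^1)\times H^1(L)$ put $D_{\mathbf A}=\nabla-i\mathbf A$, $B=b+{*d\mathbf A}$ and $$\mathcal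 V(\mathbf A,\Phi)=\frac12\int_\Sigma\Bigl(|D_{\mathbf A}\Phi|^2+B^2+\tfrac14\bigl(1-|\Phi|^2\bigr)^2\Bigr)\,d\mu_g ,$$ where $|D_{\mathbf A}\Phi|$ is the pointwise norm induced by $g$ and the Hermitian metric. If $|\Sigma|<4\pi N$, then $\mathcal V$ attains its minimum over $H^1(\Omega^1)\times H^1(L)$, and $$\min_{H^1(L\oplus\Omega^1)}\mathcal V=\pi N+\frac{(4\pi N-|\Sigma|)^2}{8|\Sigma|}.$$ The minimum is attained with $\Phi\equiv0$ and a constant-curvature connection: there are $\mathbf A\in H^1(\Omega^1)$ for which $D_{\mathbf A}$ has constant curvature ($B$ is almost everywhere equal to a constant), and for every such $\mathbf A$ the value $\mathcal V(\mathbf A,0)$ is the minimum. -/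

import Mathlib

open scoped Manifold ContDiff ENNReal Topology
open Bundle MeasureTheory Filter

noncomputable section

namespace GinzburgLandau

section Surface

/-! A Riemann surface is a manifold `M` charted on `ℂ` with holomorphic transition maps; its
underlying smooth surface is the real manifold with model `𝓘(ℝ, ℂ)`. -/

variable {M : Type*} [TopologicalSpace M] [ChartedSpace ℂ M] [IsManifold 𝓘(ℝ, ℂ) ∞ M]

/-- A smooth Riemannian metric on the surface `M`. -/
abbrev SurfaceMetric (M : Type*) [TopologicalSpace M] [ChartedSpace ℂ M]
    [IsManifold 𝓘(ℝ, ℂ) ∞ M] : Type _ :=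
  ContMDiffRiemannianMetric 𝓘(ℝ, ℂ) ∞ ℂ (fun x : M ↦ TangentSpace 𝓘(ℝ, ℂ) x)

/-- The constant-coefficient vector field `v` of the coordinate patch `chartAt ℂ x₀`, at the
point `y` of this patch: with `x₁ + i x₂` the coordinate of the patch, `coordVec x₀ 1` is
`∂/∂x₁` and `coordVec x₀ I` is `∂/∂x₂`. (It is meaningless for `y` outside the patch.) -/
def coordVec (x₀ : M) (v : ℂ) (y : M) : TangentSpace 𝓘(ℝ, ℂ) y :=
  tangentCoordChange 𝓘(ℝ, ℂ) x₀ y y v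

/-- The conformal factor `e^{2ρ}` at `y` in the coordinate patch `chartAt ℂ x₀`, that is,
`g(∂/∂x₁, ∂/∂x₁)`. -/
def confFactor (g : SurfaceMetric M) (x₀ y : M) : ℝ :=
  g.inner y (coordVec x₀ 1 y) (coordVec x₀ 1 y)

/-- The metric is compatible with the complex structure: in every coordinate patch it is
`e^{2ρ} (dx₁² + dx₂²)`. -/
def IsConformal (g : SurfaceMetric M) : Prop :=
  ∀ x₀ y : M, y ∈ (chartAt ℂ x₀).source → ∀ v w : ℂ,
    g.inner y (coordVec x₀ v y) (coordVec x₀ w y) = confFactor g x₀ y * inner ℝ v w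

/-- The area measure `dμ_g`. The supremum glues the measures `e^{2ρ} dx₁ dx₂` of the individual
coordinate patches, which agree on overlaps. -/
def areaMeasure [MeasurableSpace M] (g : SurfaceMetric M) : Measure M :=
  ⨆ x₀ : M, (((volume : Measure ℂ).restrict (chartAt ℂ x₀).target).withDensity
    fun z ↦ ENNReal.ofReal (confFactor g x₀ ((chartAt ℂ x₀).symm z))).map (chartAt ℂ x₀).symm

/-- The area `|Σ|`. -/
def area [MeasurableSpace M] (g : SurfaceMetric M) : ℝ :=
  (areaMeasure g Set.univ).toReal

/-- `f n → 0` in `L²(Σ)`, for a sequence of measurable functions. -/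
def TendstoZeroL2 [MeasurableSpace M] (g : SurfaceMetric M) (f : ℕ → M → ℝ) : Prop :=
  (∀ n, AEMeasurable (f n) (areaMeasure g)) ∧
    Tendsto (fun n ↦ ∫⁻ x, ENNReal.ofReal (f n x ^ 2) ∂(areaMeasure g)) atTop (𝓝 0)

/-- (Not necessarily continuous) real 1-forms on the surface. -/
abbrev OneForm (M : Type*) [TopologicalSpace M] [ChartedSpace ℂ M] : Type _ :=
  Π x : M, TangentSpace 𝓘(ℝ, ℂ) x →L[ℝ] ℝ

/-- The coefficient `A(v)` of the 1-form `A` as a function of the coordinate of the patch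
`chartAt ℂ x₀`: for `v = 1` it is `A₁`, for `v = I` it is `A₂`, where `A = A₁ dx₁ + A₂ dx₂`. -/
def coeff (A : OneForm M) (x₀ : M) (v : ℂ) (z : ℂ) : ℝ :=
  A ((chartAt ℂ x₀).symm z) (coordVec x₀ v ((chartAt ℂ x₀).symm z))

/-- A 1-form is smooth if its coefficients are smooth in every coordinate patch. -/
def OneForm.IsSmooth (A : OneForm M) : Prop :=
  ∀ (x₀ : M) (v : ℂ), ContDiffOn ℝ ∞ (coeff A x₀ v) (chartAt ℂ x₀).target

/-- `*dA = e^{-2ρ} (∂₁ A₂ - ∂₂ A₁)` for a smooth 1-form `A`. -/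
def curl (g : SurfaceMetric M) (A : OneForm M) (x : M) : ℝ :=
  (confFactor g x x)⁻¹ * (fderiv ℝ (coeff A x Complex.I) (chartAt ℂ x x) 1
    - fderiv ℝ (coeff A x 1) (chartAt ℂ x x) Complex.I)

/-- `div A = e^{-2ρ} (∂₁ A₁ + ∂₂ A₂)` for a smooth 1-form `A`. -/
def divg (g : SurfaceMetric M) (A : OneForm M) (x : M) : ℝ :=
  (confFactor g x x)⁻¹ * (fderiv ℝ (coeff A x 1) (chartAt ℂ x x) 1
    + fderiv ℝ (coeff A x Complex.I) (chartAt ℂ x x) Complex.I)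

/-- The pointwise norm of a 1-form with values in normed spaces `V x`:
`|ψ|² = e^{-2ρ} (|ψ₁|² + |ψ₂|²)`. -/
def formNorm {V : M → Type*} [∀ x, NormedAddCommGroup (V x)] [∀ x, NormedSpace ℝ (V x)]
    (g : SurfaceMetric M) (x : M) (ψ : TangentSpace 𝓘(ℝ, ℂ) x →L[ℝ] V x) : ℝ :=
  √((confFactor g x x)⁻¹ * (‖ψ (coordVec x 1 x)‖ ^ 2 + ‖ψ (coordVec x Complex.I x)‖ ^ 2))

/-- `A ∈ H¹(Ω¹)`, with `*dA = β` in the weak sense. Here `H¹(Ω¹)` is the completion of the smooth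
1-forms in the norm `(‖A‖² + ‖dA‖² + ‖δA‖²)^{1/2}` (`L²` norms) of the Hodge Laplacian. -/
def IsH1OneForm [MeasurableSpace M] (g : SurfaceMetric M) (A : OneForm M) (β : M → ℝ) : Prop :=
  ∃ (a : ℕ → OneForm M) (γ : M → ℝ), (∀ n, (a n).IsSmooth) ∧
    TendstoZeroL2 g (fun n x ↦ formNorm (V := fun _ ↦ ℝ) g x (a n x - A x)) ∧
    TendstoZeroL2 g (fun n x ↦ curl g (a n) x - β x) ∧
    TendstoZeroL2 g (fun n x ↦ divg g (a n) x - γ x)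

/-- The space `H¹(Ω¹)`. -/
def H1OneForm [MeasurableSpace M] (g : SurfaceMetric M) : Set (OneForm M) :=
  {A | ∃ β, IsH1OneForm g A β}

end Surface

section LineBundle

/-! A smooth Hermitian line bundle `L` on the surface: a complex line bundle which is smooth over
the underlying real manifold, with a Hermitian inner product on the fibres that varies smoothly
with the base point. -/

variable {M : Type*} [TopologicalSpace M] [ChartedSpace ℂ M] [IsManifold 𝓘(ℝ, ℂ) ∞ M]
  {L : M → Type*} [∀ x, NormedAddCommGroup (L x)] [∀ x, InnerProductSpace ℂ (L x)]
  [TopologicalSpace (TotalSpace ℂ L)] [FiberBundle ℂ L] [VectorBundle ℂ ℂ L]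
  [VectorBundle ℝ ℂ L]

/-- Smooth sections of `L`. -/
def IsSmoothSection (σ : Π x, L x) : Prop :=
  ContMDiff 𝓘(ℝ, ℂ) (𝓘(ℝ, ℂ).prod 𝓘(ℝ, ℂ)) ∞ (fun x ↦ TotalSpace.mk' ℂ x (σ x))

/-- The Hermitian metric of `L` is smooth: the pointwise inner product of two smooth sections is
a smooth function. -/
def IsSmoothHermitian (L : M → Type*) [∀ x, NormedAddCommGroup (L x)]
    [∀ x, InnerProductSpace ℂ (L x)] [TopologicalSpace (TotalSpace ℂ L)] [FiberBundle ℂ L] :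
    Prop :=
  ∀ σ τ : Π x, L x, IsSmoothSection σ → IsSmoothSection τ →
    ContMDiff 𝓘(ℝ, ℂ) 𝓘(ℝ, ℂ) ∞ (fun x ↦ inner ℂ (σ x) (τ x))

/-- `cov` is (the covariant derivative of) a smooth `S¹` connection on `L`: it is smooth,
complex linear, and compatible with the Hermitian metric. -/
structure IsUnitaryConnection (cov : CovariantDerivative 𝓘(ℝ, ℂ) ℂ L) : Prop where
  smooth : cov.ContMDiffCovariantDerivative ∞
  complex_linear : ∀ (σ : Π x, L x), IsSmoothSection σ → ∀ (x : M)
    (v : TangentSpace 𝓘(ℝ, ℂ) x), cov (fun y ↦ Complex.I • σ y) x v = Complex.I • cov σ x v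
  metric : ∀ (σ τ : Π x, L x), IsSmoothSection σ → IsSmoothSection τ → ∀ (x : M)
    (v : TangentSpace 𝓘(ℝ, ℂ) x),
    mfderiv 𝓘(ℝ, ℂ) 𝓘(ℝ, ℂ) (fun y ↦ inner ℂ (σ y) (τ y)) x v
      = (inner ℂ (cov σ x v) (τ x) + inner ℂ (σ x) (cov τ x v) : ℂ)

/-- The connection `cov = ∇` has curvature 2-form `-i F` with `F = B dμ_g`: in every coordinate
patch, `[∇₁, ∇₂] σ = -i B e^{2ρ} σ`. -/
def HasCurvature (g : SurfaceMetric M) (cov : CovariantDerivative 𝓘(ℝ, ℂ) ℂ L) (B : M → ℝ) :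
    Prop :=
  ∀ (σ : Π x, L x), IsSmoothSection σ → ∀ x₀ y : M, y ∈ (chartAt ℂ x₀).source →
    cov (fun x ↦ cov σ x (coordVec x₀ Complex.I x)) y (coordVec x₀ 1 y)
      - cov (fun x ↦ cov σ x (coordVec x₀ 1 x)) y (coordVec x₀ Complex.I y)
      = (-Complex.I * (B y : ℂ) * (confFactor g x₀ y : ℂ)) • σ y

/-- `L` has degree `N`, by Chern-Weil: `∫ B dμ_g = 2 π N`, where `-i B dμ_g` is the curvature of a
smooth `S¹` connection on `L`. (The integral does not depend on the connection, nor on `g`.) -/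
def HasDegree [MeasurableSpace M] (g : SurfaceMetric M) (L : M → Type*)
    [∀ x, NormedAddCommGroup (L x)] [∀ x, InnerProductSpace ℂ (L x)]
    [TopologicalSpace (TotalSpace ℂ L)] [FiberBundle ℂ L] [VectorBundle ℂ ℂ L]
    [VectorBundle ℝ ℂ L] (N : ℤ) : Prop :=
  ∃ (cov : CovariantDerivative 𝓘(ℝ, ℂ) ℂ L) (B : M → ℝ), IsUnitaryConnection cov ∧
    HasCurvature g cov B ∧ Integrable B (areaMeasure g) ∧
    ∫ x, B x ∂(areaMeasure g) = 2 * Real.pi * N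

/-- `Φ ∈ H¹(L)`, with weak covariant derivative `ψ = ∇Φ`. Here `H¹(L)` is the completion of the
smooth sections in the norm `(∫ |Φ|² + |∇Φ|² dμ_g)^{1/2}`. -/
def IsH1Section [MeasurableSpace M] (g : SurfaceMetric M)
    (cov : CovariantDerivative 𝓘(ℝ, ℂ) ℂ L) (Φ : Π x, L x)
    (ψ : Π x, TangentSpace 𝓘(ℝ, ℂ) x →L[ℝ] L x) : Prop :=
  ∃ σ : ℕ → Π x, L x, (∀ n, IsSmoothSection (σ n)) ∧
    TendstoZeroL2 g (fun n x ↦ ‖σ n x - Φ x‖) ∧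
    TendstoZeroL2 g (fun n x ↦ formNorm g x (cov (σ n) x - ψ x))

/-- The space `H¹(L)`. -/
def H1Section [MeasurableSpace M] (g : SurfaceMetric M)
    (cov : CovariantDerivative 𝓘(ℝ, ℂ) ℂ L) : Set (Π x, L x) :=
  {Φ | ∃ ψ, IsH1Section g cov Φ ψ}

/-- `D_A Φ = ∇Φ - i A Φ` at the point `x`, where `ψ = ∇Φ`. -/
def covDeriv (A : OneForm M) (Φ : Π x, L x) (ψ : Π x, TangentSpace 𝓘(ℝ, ℂ) x →L[ℝ] L x)
    (x : M) : TangentSpace 𝓘(ℝ, ℂ) x →L[ℝ] L x :=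
  ψ x - (A x).smulRight (Complex.I • Φ x)

/-- The energy density `|D_A Φ|² + B² + (1 - |Φ|²)² / 4`, where `ψ = ∇Φ`. -/
def energyDensity (g : SurfaceMetric M) (A : OneForm M) (Φ : Π x, L x)
    (ψ : Π x, TangentSpace 𝓘(ℝ, ℂ) x →L[ℝ] L x) (B : M → ℝ) (x : M) : ℝ :=
  formNorm g x (covDeriv A Φ ψ x) ^ 2 + B x ^ 2 + (1 - ‖Φ x‖ ^ 2) ^ 2 / 4

/-- The Ginzburg-Landau energy `𝒱(A, Φ)` of `A ∈ H¹(Ω¹)` and `Φ ∈ H¹(L)`, where `D_A = ∇ - i A`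
and `∇ = cov` is a connection of constant curvature `b`, so that `D_A` has magnetic field
`B = b + *dA`. The weak derivatives `ψ = ∇Φ` and `β = *dA` are unique almost everywhere, so the
infimum merely inserts them (and gives `∞` if `A` or `Φ` is not in `H¹`). -/
def energy [MeasurableSpace M] (g : SurfaceMetric M) (cov : CovariantDerivative 𝓘(ℝ, ℂ) ℂ L)
    (b : ℝ) (A : OneForm M) (Φ : Π x, L x) : ℝ≥0∞ :=
  ⨅ (ψ : Π x, TangentSpace 𝓘(ℝ, ℂ) x →L[ℝ] L x) (β : M → ℝ) (_ : IsH1Section g cov Φ ψ)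
    (_ : IsH1OneForm g A β),
    2⁻¹ * ∫⁻ x, ENNReal.ofReal (energyDensity g A Φ ψ (fun y ↦ b + β y) x) ∂(areaMeasure g)

/-- For `A ∈ H¹(Ω¹)`: the connection `D_A = ∇ - i A`, where `∇` has constant curvature `b`, has
constant curvature, that is, `B = b + *dA` is almost everywhere equal to a constant. -/
def IsConstantCurvature [MeasurableSpace M] (g : SurfaceMetric M) (b : ℝ) (A : OneForm M) :
    Prop :=
  ∃ (β : M → ℝ) (c : ℝ), IsH1OneForm g A β ∧ ∀ᵐ x ∂(areaMeasure g), b + β x = c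

end LineBundle

end GinzburgLandau

end

/-! Write S = |Φ|². The engine is the Bogomolny inequality ∫ B S ≤ ∫ |D_A Φ|². For smooth fields the
current Im ⟨Φ, D_A Φ⟩ has curl 2 e^{-2ρ} Im ⟨D₁Φ, D₂Φ⟩ - B S, which is at most |D_A Φ|² - B S, and
its integral vanishes by Stokes (`integral_curl`).

The rest of the density is B S + B² + (1 - S)²/4 = B + y² with y = B - (1 - S)/2. Replacing y² by
its tangent 2ty - t² at some t ≥ 0 and dropping t S ≥ 0 leaves (1 + 2t) B - (t + t²), which is
affine in B (`integral_density_ge`). Since ∫ B = 2πN (`curvature_mul_area`, `integral_weak_curl`),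
the best choice t = (4πN - |Σ|)/(2|Σ|) gives the bound; the area hypothesis makes t nonnegative. For
Φ = 0 and constant B one has y = B - 1/2 = t, so nothing is lost (`energy_zero_section`).

For H¹ fields the products A Φ and B S have no evident integrable majorant along a smooth
approximation. The current is therefore multiplied by h = (1 + εS)⁻¹. Because the fibre is a complex
line, dS ∧ Im ⟨Φ, D_A Φ⟩ is again a multiple of Im ⟨D₁Φ, D₂Φ⟩, and the total coefficient h + S h' =
(1 + εS)⁻² remains nonnegative (`curl_weightedCurrent_le`). With this weight every factor S costs at
most 1/ε, so dominated convergence passes to H¹ (`h1_weighted_le`) without Sobolev embeddings; then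
ε → 0 under finite energy (`integral_mul_norm_sq_le`). -/

noncomputable section

set_option linter.unusedSectionVars false

namespace GinzburgLandau

/-! ### Holomorphic changes of coordinates and the conformal factor. -/

section Coordinates

variable {M : Type*} [TopologicalSpace M] [ChartedSpace ℂ M]

/-- The complex derivative at `y` of the transition map from the patch of `x₀` to that of `x₁`. -/
def transDeriv (x₀ x₁ y : M) : ℂ :=
  deriv (chartAt ℂ x₁ ∘ (chartAt ℂ x₀).symm) (chartAt ℂ x₀ y)

theorem contDiffAt_transition [IsManifold 𝓘(ℂ, ℂ) ω M] {x₀ x₁ y : M}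
    (h₀ : y ∈ (chartAt ℂ x₀).source) (h₁ : y ∈ (chartAt ℂ x₁).source) :
    ContDiffAt ℂ ω (chartAt ℂ x₁ ∘ (chartAt ℂ x₀).symm) (chartAt ℂ x₀ y) := by
  have h := contDiffWithinAt_ext_coord_change (I := 𝓘(ℂ, ℂ)) (n := ω) x₁ x₀
    (y := chartAt ℂ x₀ y) (by simp [PartialEquiv.trans_source, h₀, h₁])
  simpa [contDiffWithinAt_univ] using h

theorem hasDerivAt_transition [IsManifold 𝓘(ℂ, ℂ) ω M] {x₀ x₁ y : M}
    (h₀ : y ∈ (chartAt ℂ x₀).source) (h₁ : y ∈ (chartAt ℂ x₁).source) :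
    HasDerivAt (chartAt ℂ x₁ ∘ (chartAt ℂ x₀).symm) (transDeriv x₀ x₁ y) (chartAt ℂ x₀ y) :=
  ((contDiffAt_transition h₀ h₁).differentiableAt (by simp)).hasDerivAt

variable [IsManifold 𝓘(ℝ, ℂ) ∞ M]

theorem coordVec_self {x : M} (v : ℂ) : coordVec x v x = v :=
  tangentCoordChange_self (I := 𝓘(ℝ, ℂ)) (by simp)

theorem coordVec_add (x₀ y : M) (v w : ℂ) :
    coordVec x₀ (v + w) y = coordVec x₀ v y + coordVec x₀ w y :=
  map_add (tangentCoordChange 𝓘(ℝ, ℂ) x₀ y y) v w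

theorem coordVec_smul (x₀ y : M) (r : ℝ) (v : ℂ) :
    coordVec x₀ (r • v) y = r • coordVec x₀ v y :=
  map_smul (tangentCoordChange 𝓘(ℝ, ℂ) x₀ y y) r v

theorem coordVec_eq_re_add_im (x₀ y : M) (v : ℂ) :
    coordVec x₀ v y = v.re • coordVec x₀ 1 y + v.im • coordVec x₀ Complex.I y := by
  rw [← coordVec_smul, ← coordVec_smul, ← coordVec_add]
  congr 1
  simp [Complex.re_add_im]

theorem coordVec_ne_zero {x₀ y : M} (h₀ : y ∈ (chartAt ℂ x₀).source) {v : ℂ} (hv : v ≠ 0) :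
    coordVec x₀ v y ≠ 0 := by
  intro h
  have h1 : tangentCoordChange 𝓘(ℝ, ℂ) y x₀ y (tangentCoordChange 𝓘(ℝ, ℂ) x₀ y y v) = v := by
    rw [tangentCoordChange_comp (I := 𝓘(ℝ, ℂ)) (by simp [h₀])]
    exact tangentCoordChange_self (I := 𝓘(ℝ, ℂ)) (by simp [h₀])
  apply hv
  rw [← h1]
  have : tangentCoordChange 𝓘(ℝ, ℂ) x₀ y y v = 0 := h
  rw [this, map_zero]

theorem confFactor_pos (g : SurfaceMetric M) {x₀ y : M} (h₀ : y ∈ (chartAt ℂ x₀).source) :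
    0 < confFactor g x₀ y :=
  g.pos y _ (coordVec_ne_zero h₀ one_ne_zero)

variable [IsManifold 𝓘(ℂ, ℂ) ω M]

theorem tangentCoordChange_eq_mul {x₀ x₁ y : M}
    (h₀ : y ∈ (chartAt ℂ x₀).source) (h₁ : y ∈ (chartAt ℂ x₁).source) (v : ℂ) :
    tangentCoordChange 𝓘(ℝ, ℂ) x₀ x₁ y v = transDeriv x₀ x₁ y * v := by
  have h := hasFDerivWithinAt_tangentCoordChange (I := 𝓘(ℝ, ℂ)) (x := x₀) (y := x₁) (z := y)
    (by simp [h₀, h₁])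
  have h' : HasFDerivAt (chartAt ℂ x₁ ∘ (chartAt ℂ x₀).symm)
      (tangentCoordChange 𝓘(ℝ, ℂ) x₀ x₁ y) (chartAt ℂ x₀ y) := by
    simpa [hasFDerivWithinAt_univ] using h
  have h'' := (hasDerivAt_transition h₀ h₁).hasFDerivAt.restrictScalars ℝ
  rw [h'.unique h'']
  simp [mul_comm]

theorem coordVec_change {x₀ x₁ y : M}
    (h₀ : y ∈ (chartAt ℂ x₀).source) (h₁ : y ∈ (chartAt ℂ x₁).source) (v : ℂ) :
    coordVec x₀ v y = coordVec x₁ (transDeriv x₀ x₁ y * v) y := by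
  rw [← tangentCoordChange_eq_mul h₀ h₁]
  exact (tangentCoordChange_comp (I := 𝓘(ℝ, ℂ)) (by simp [h₀, h₁])).symm

theorem confFactor_change {g : SurfaceMetric M} (hg : IsConformal g) {x₀ x₁ y : M}
    (h₀ : y ∈ (chartAt ℂ x₀).source) (h₁ : y ∈ (chartAt ℂ x₁).source) :
    confFactor g x₀ y = ‖transDeriv x₀ x₁ y‖ ^ 2 * confFactor g x₁ y := by
  rw [confFactor, coordVec_change h₀ h₁, hg x₁ y h₁]
  simp [mul_comm]

theorem transDeriv_ne_zero {x₀ x₁ y : M}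
    (h₀ : y ∈ (chartAt ℂ x₀).source) (h₁ : y ∈ (chartAt ℂ x₁).source) :
    transDeriv x₀ x₁ y ≠ 0 := by
  intro h
  have := coordVec_change h₀ h₁ 1
  rw [h, zero_mul] at this
  exact coordVec_ne_zero h₀ one_ne_zero
    (this.trans (map_zero (tangentCoordChange 𝓘(ℝ, ℂ) x₁ y y)))

theorem confFactor_inv_mul {g : SurfaceMetric M} (hg : IsConformal g) {x₀ x₁ y : M}
    (h₀ : y ∈ (chartAt ℂ x₀).source) (h₁ : y ∈ (chartAt ℂ x₁).source) :
    (confFactor g x₀ y)⁻¹ * ‖transDeriv x₀ x₁ y‖ ^ 2 = (confFactor g x₁ y)⁻¹ := by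
  have h2 := (confFactor_pos g h₁).ne'
  have h3 : ‖transDeriv x₀ x₁ y‖ ≠ 0 := norm_ne_zero_iff.2 (transDeriv_ne_zero h₀ h₁)
  rw [confFactor_change hg h₀ h₁]
  field_simp

/-- The squared norm of a 1-form, computed in an arbitrary coordinate patch. -/
theorem formNorm_sq {V : M → Type*} [∀ x, NormedAddCommGroup (V x)]
    [∀ x, InnerProductSpace ℝ (V x)] {g : SurfaceMetric M} (hg : IsConformal g) {x₀ y : M}
    (h₀ : y ∈ (chartAt ℂ x₀).source) (ψ : TangentSpace 𝓘(ℝ, ℂ) y →L[ℝ] V y) :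
    formNorm g y ψ ^ 2 = (confFactor g x₀ y)⁻¹ *
      (‖ψ (coordVec x₀ 1 y)‖ ^ 2 + ‖ψ (coordVec x₀ Complex.I y)‖ ^ 2) := by
  have hy : y ∈ (chartAt ℂ y).source := mem_chart_source ℂ y
  have hpos := confFactor_pos g hy
  rw [formNorm, Real.sq_sqrt (by positivity), ← confFactor_inv_mul hg hy h₀, mul_assoc]
  congr 1
  set c := transDeriv y x₀ y
  rw [coordVec_change hy h₀, coordVec_change hy h₀ Complex.I, coordVec_eq_re_add_im x₀ y (_ * 1),
    coordVec_eq_re_add_im x₀ y (_ * Complex.I)]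
  simp only [mul_one, Complex.mul_re, Complex.mul_im, Complex.I_re, Complex.I_im, mul_zero,
    zero_sub, add_zero, map_add, map_smul]
  -- The vectors c and c I are orthogonal of equal length, so the cross terms cancel and the sum
  -- scales by |c|².
  rw [norm_add_sq_real, norm_add_sq_real]
  simp only [norm_smul, mul_pow, Real.norm_eq_abs, sq_abs, inner_smul_left, inner_smul_right,
    conj_trivial, ← Complex.normSq_eq_norm_sq, Complex.normSq_apply]
  ring

end Coordinates

/-! ### Coordinate independence of `*dA`. -/

section Curl

variable {M : Type*} [TopologicalSpace M] [ChartedSpace ℂ M] [IsManifold 𝓘(ℝ, ℂ) ∞ M]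

theorem coeff_eq_re_im (A : OneForm M) (x₀ : M) (v z : ℂ) :
    coeff A x₀ v z = v.re * coeff A x₀ 1 z + v.im * coeff A x₀ Complex.I z := by
  rw [coeff, coordVec_eq_re_add_im, map_add, map_smul, map_smul]
  rfl

theorem OneForm.IsSmooth.differentiableAt_coeff {A : OneForm M} (hA : A.IsSmooth) {x₀ : M} (v : ℂ)
    {z : ℂ} (hz : z ∈ (chartAt ℂ x₀).target) : DifferentiableAt ℝ (coeff A x₀ v) z :=
  ((hA x₀ v).contDiffAt ((chartAt ℂ x₀).open_target.mem_nhds hz)).differentiableAt (by simp)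

variable [IsManifold 𝓘(ℂ, ℂ) ω M]

/-- `*dA` computed in an arbitrary coordinate patch. -/
theorem curl_eq {g : SurfaceMetric M} (hg : IsConformal g) {A : OneForm M} (hA : A.IsSmooth)
    {x₀ y : M} (h₀ : y ∈ (chartAt ℂ x₀).source) :
    curl g A y = (confFactor g x₀ y)⁻¹ *
      (fderiv ℝ (coeff A x₀ Complex.I) (chartAt ℂ x₀ y) 1
        - fderiv ℝ (coeff A x₀ 1) (chartAt ℂ x₀ y) Complex.I) := by
  have hy : y ∈ (chartAt ℂ y).source := mem_chart_source ℂ y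
  set φ := chartAt ℂ y with hφ
  set φ₀ := chartAt ℂ x₀ with hφ₀
  set τ : ℂ → ℂ := φ₀ ∘ φ.symm with hτ
  set c := transDeriv y x₀ y with hc
  have hτs : ContDiffAt ℂ ω τ (φ y) := contDiffAt_transition hy h₀
  have hd : HasDerivAt τ c (φ y) := hasDerivAt_transition hy h₀
  have hdR : HasFDerivAt τ ((ContinuousLinearMap.toSpanSingleton ℂ c).restrictScalars ℝ) (φ y) :=
    hd.hasFDerivAt.restrictScalars ℝ
  have hτy : τ (φ y) = φ₀ y := by simp [hτ, φ.left_inv hy]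
  have hd2 : DifferentiableAt ℂ (deriv τ) (φ y) := by
    have := (hτs.fderiv_right (m := 1) (by simp)).differentiableAt (by simp)
    exact this.clm_apply (differentiableAt_const (1 : ℂ))
  set d := deriv (deriv τ) (φ y)
  have hd2R : HasFDerivAt (deriv τ)
      ((ContinuousLinearMap.toSpanSingleton ℂ d).restrictScalars ℝ) (φ y) :=
    hd2.hasDerivAt.hasFDerivAt.restrictScalars ℝ
  -- Pullback along the transition map τ: multiplication by τ' rotates and scales the coordinate
  -- vectors.
  have hev : ∀ v : ℂ, coeff A y v =ᶠ[𝓝 (φ y)] fun z ↦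
      (deriv τ z * v).re * coeff A x₀ 1 (τ z) + (deriv τ z * v).im * coeff A x₀ Complex.I (τ z) := by
    intro v
    have h1 : ∀ᶠ z in 𝓝 (φ y), z ∈ φ.target := φ.open_target.mem_nhds (φ.map_source hy)
    have h2 : ∀ᶠ z in 𝓝 (φ y), φ.symm z ∈ φ₀.source := by
      apply (φ.continuousAt_symm (φ.map_source hy)).eventually_mem
      rw [φ.left_inv hy]
      exact φ₀.open_source.mem_nhds h₀
    filter_upwards [h1, h2] with z hz1 hz2
    have hs : φ.symm z ∈ φ.source := φ.map_target hz1
    have e1 : transDeriv y x₀ (φ.symm z) = deriv τ z := by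
      rw [transDeriv, φ.right_inv hz1]
    have e2 : φ₀.symm (τ z) = φ.symm z := φ₀.left_inv hz2
    rw [coeff, coordVec_change hs hz2, e1, ← e2]
    exact coeff_eq_re_im A x₀ _ (τ z)
  have hz₀ : φ₀ y ∈ φ₀.target := φ₀.map_source h₀
  have ha : ∀ v, HasFDerivAt (fun z ↦ coeff A x₀ v (τ z))
      ((fderiv ℝ (coeff A x₀ v) (φ₀ y)).comp
        ((ContinuousLinearMap.toSpanSingleton ℂ c).restrictScalars ℝ)) (φ y) := by
    intro v
    have h := (hA.differentiableAt_coeff v hz₀).hasFDerivAt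
    rw [← hτy] at h ⊢
    exact h.comp (φ y) hdR
  have hmul : ∀ v, HasFDerivAt (fun z ↦ deriv τ z * v)
      (v • (ContinuousLinearMap.toSpanSingleton ℂ d).restrictScalars ℝ) (φ y) :=
    fun v ↦ hd2R.mul_const' v |>.congr_fderiv (by ext; simp)
  -- The terms with the second derivative d depend only on the product v * w, so they cancel in the
  -- antisymmetrisation. The first-order terms contribute the real Jacobian |c|².
  have key : ∀ v w, fderiv ℝ (coeff A y v) (φ y) w =
      (c * v).re * fderiv ℝ (coeff A x₀ 1) (φ₀ y) (w * c)
        + coeff A x₀ 1 (φ₀ y) * (v * (w * d)).re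
        + ((c * v).im * fderiv ℝ (coeff A x₀ Complex.I) (φ₀ y) (w * c)
        + coeff A x₀ Complex.I (φ₀ y) * (v * (w * d)).im) := by
    intro v w
    rw [(hev v).fderiv_eq]
    have hre := Complex.reCLM.hasFDerivAt.comp (φ y) (hmul v)
    have him := Complex.imCLM.hasFDerivAt.comp (φ y) (hmul v)
    have := ((hre.mul (ha 1)).add (him.mul (ha Complex.I))).fderiv
    erw [this]
    simp [hτy, hd.deriv]
  have hlin : ∀ v, ∀ w : ℂ, fderiv ℝ (coeff A x₀ v) (φ₀ y) w =
      w.re * fderiv ℝ (coeff A x₀ v) (φ₀ y) 1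
        + w.im * fderiv ℝ (coeff A x₀ v) (φ₀ y) Complex.I := by
    intro v w
    conv_lhs => rw [← Complex.re_add_im w]
    rw [← mul_one (w.re : ℂ), ← Complex.real_smul, ← Complex.real_smul, map_add, map_smul, map_smul]
    rfl
  rw [curl, ← confFactor_inv_mul hg hy h₀, ← hφ, key, key, mul_assoc]
  congr 1
  rw [hlin 1 (1 * c), hlin Complex.I (1 * c), hlin 1 (Complex.I * c),
    hlin Complex.I (Complex.I * c), ← Complex.normSq_eq_norm_sq, Complex.normSq_apply]
  simp
  ring

end Curl

/-! ### Smoothness of coordinate fields and of the conformal factor. -/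

section Smooth

variable {M : Type*} [TopologicalSpace M] [ChartedSpace ℂ M] [IsManifold 𝓘(ℝ, ℂ) ∞ M]

theorem contMDiffAt_coordVec {x₀ y : M} (h₀ : y ∈ (chartAt ℂ x₀).source) (v : ℂ) :
    ContMDiffAt 𝓘(ℝ, ℂ) (𝓘(ℝ, ℂ).prod 𝓘(ℝ, ℂ)) ∞
      (fun y ↦ TotalSpace.mk' ℂ (E := fun x : M ↦ TangentSpace 𝓘(ℝ, ℂ) x) y (coordVec x₀ v y)) y := by
  have h := (trivializationAt ℂ (fun x : M ↦ TangentSpace 𝓘(ℝ, ℂ) x) x₀).contMDiffAt_symmL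
    (𝕜 := ℝ) (IB := 𝓘(ℝ, ℂ)) (n := ∞) (x := y) h₀
  have hc : ContMDiffAt 𝓘(ℝ, ℂ) (𝓘(ℝ, ℂ).prod 𝓘(ℝ, ℂ)) ∞
      (fun y : M ↦ TotalSpace.mk' ℂ (E := Bundle.Trivial M ℂ) y v) y := by
    rw [contMDiffAt_section]
    exact contMDiffAt_const
  refine (h.clm_bundle_apply (E₁ := Bundle.Trivial M ℂ) hc).congr_of_eventuallyEq ?_
  filter_upwards [(chartAt ℂ x₀).open_source.mem_nhds h₀] with p hp
  rw [TangentBundle.symmL_trivializationAt_eq_core hp]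
  rfl

theorem contMDiffAt_confFactor (g : SurfaceMetric M) {x₀ y : M}
    (h₀ : y ∈ (chartAt ℂ x₀).source) :
    ContMDiffAt 𝓘(ℝ, ℂ) 𝓘(ℝ, ℝ) ∞ (confFactor g x₀) y := by
  have h : ContMDiffAt 𝓘(ℝ, ℂ) (𝓘(ℝ, ℂ).prod 𝓘(ℝ, ℝ)) ∞
      (fun m ↦ TotalSpace.mk' ℝ (E := Bundle.Trivial M ℝ) m (confFactor g x₀ m)) y :=
    ContMDiffAt.clm_bundle_apply₂ (F₁ := ℂ) (F₂ := ℂ)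
      (E₁ := fun x : M ↦ TangentSpace 𝓘(ℝ, ℂ) x) (E₂ := fun x : M ↦ TangentSpace 𝓘(ℝ, ℂ) x)
      (E₃ := Bundle.Trivial M ℝ) g.contMDiff.contMDiffAt
      (contMDiffAt_coordVec h₀ 1) (contMDiffAt_coordVec h₀ 1)
  simp only [contMDiffAt_totalSpace] at h
  exact h.2

theorem continuousOn_confFactor (g : SurfaceMetric M) (x₀ : M) :
    ContinuousOn (confFactor g x₀) (chartAt ℂ x₀).source :=
  fun _ hy ↦ (contMDiffAt_confFactor g hy).continuousAt.continuousWithinAt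

theorem continuousOn_confFactor_symm (g : SurfaceMetric M) (x₀ : M) :
    ContinuousOn (fun z ↦ confFactor g x₀ ((chartAt ℂ x₀).symm z)) (chartAt ℂ x₀).target :=
  (continuousOn_confFactor g x₀).comp (chartAt ℂ x₀).continuousOn_symm
    (chartAt ℂ x₀).mapsTo_symm

end Smooth

/-! ### The area measure: gluing of patches, finiteness, integration in a patch. -/

section Measure

variable {M : Type*} [TopologicalSpace M] [ChartedSpace ℂ M] [IsManifold 𝓘(ℝ, ℂ) ∞ M]
  [MeasurableSpace M] [BorelSpace M]

/-- The measure `e^{2ρ} dx₁ dx₂` of a single coordinate patch. -/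
def patchMeasure (g : SurfaceMetric M) (x₀ : M) : Measure M :=
  (((volume : Measure ℂ).restrict (chartAt ℂ x₀).target).withDensity
    fun z ↦ ENNReal.ofReal (confFactor g x₀ ((chartAt ℂ x₀).symm z))).map (chartAt ℂ x₀).symm

omit [IsManifold 𝓘(ℝ, ℂ) ∞ M] in
theorem aemeasurable_chart_symm (x₀ : M) :
    AEMeasurable (chartAt ℂ x₀).symm ((volume : Measure ℂ).restrict (chartAt ℂ x₀).target) :=
  (chartAt ℂ x₀).continuousOn_symm.aemeasurable (chartAt ℂ x₀).open_target.measurableSet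

omit [BorelSpace M] in
theorem patchMeasure_le (g : SurfaceMetric M) (x₀ : M) : patchMeasure g x₀ ≤ areaMeasure g :=
  le_iSup (patchMeasure g) x₀

theorem patchMeasure_apply (g : SurfaceMetric M) (x₀ : M) {S : Set M} (hS : MeasurableSet S) :
    patchMeasure g x₀ S = ∫⁻ z in (chartAt ℂ x₀).symm ⁻¹' S ∩ (chartAt ℂ x₀).target,
      ENNReal.ofReal (confFactor g x₀ ((chartAt ℂ x₀).symm z)) := by
  rw [patchMeasure, Measure.map_apply_of_aemeasurable
    ((aemeasurable_chart_symm x₀).mono_ac (withDensity_absolutelyContinuous _ _)) hS,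
    withDensity_apply', Measure.restrict_restrict' (chartAt ℂ x₀).open_target.measurableSet]

theorem patchMeasure_restrict_source (g : SurfaceMetric M) (x₀ : M) :
    (patchMeasure g x₀).restrict (chartAt ℂ x₀).source = patchMeasure g x₀ := by
  refine Measure.restrict_eq_self_of_ae_mem (mem_ae_iff.2 ?_)
  change patchMeasure g x₀ (chartAt ℂ x₀).sourceᶜ = 0
  rw [patchMeasure_apply _ _ (chartAt ℂ x₀).open_source.measurableSet.compl]
  convert! MeasureTheory.setLIntegral_empty _ using 3
  ext z
  simp only [Set.mem_inter_iff, Set.mem_preimage, Set.mem_compl_iff, Set.mem_empty_iff_false,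
    iff_false, not_and]
  intro h h'
  exact h ((chartAt ℂ x₀).map_target h')

omit [IsManifold 𝓘(ℝ, ℂ) ∞ M] in
theorem measurableSet_chart_symm_preimage (x₀ : M) {S : Set M} (hS : MeasurableSet S) :
    MeasurableSet ((chartAt ℂ x₀).symm ⁻¹' S ∩ (chartAt ℂ x₀).target) := by
  have h := (continuousOn_iff_continuous_domRestrict.1 (chartAt ℂ x₀).continuousOn_symm).measurable hS
  have := (chartAt ℂ x₀).open_target.measurableSet.subtype_image h
  convert! this using 1
  ext z
  simp [and_comm]

theorem det_toSpanSingleton_restrictScalars (c : ℂ) :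
    ((ContinuousLinearMap.toSpanSingleton ℂ c).restrictScalars ℝ : ℂ →L[ℝ] ℂ).det
      = ‖c‖ ^ 2 := by
  rw [← Complex.normSq_eq_norm_sq, ← Algebra.norm_complex_apply, Algebra.norm_apply]
  refine congrArg LinearMap.det (LinearMap.ext fun z ↦ ?_)
  simp [mul_comm]

variable [IsManifold 𝓘(ℂ, ℂ) ω M]

/-- The measures of two coordinate patches agree on the overlap. -/
theorem patchMeasure_congr {g : SurfaceMetric M} (hg : IsConformal g) {x₀ x₁ : M} {S : Set M}
    (hS : MeasurableSet S) (h₀ : S ⊆ (chartAt ℂ x₀).source) (h₁ : S ⊆ (chartAt ℂ x₁).source) :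
    patchMeasure g x₀ S = patchMeasure g x₁ S := by
  rw [patchMeasure_apply _ _ hS, patchMeasure_apply _ _ hS]
  set φ := chartAt ℂ x₀
  set φ₁ := chartAt ℂ x₁
  have himg : (φ₁ ∘ φ.symm) '' (φ.symm ⁻¹' S ∩ φ.target) = φ₁.symm ⁻¹' S ∩ φ₁.target := by
    ext w
    constructor
    · rintro ⟨z, ⟨hz, -⟩, rfl⟩
      refine ⟨?_, φ₁.map_source (h₁ hz)⟩
      simpa [φ₁.left_inv (h₁ hz)] using hz
    · rintro ⟨hw, hw'⟩
      refine ⟨φ (φ₁.symm w), ⟨?_, φ.map_source (h₀ hw)⟩, ?_⟩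
      · simpa [φ.left_inv (h₀ hw)] using hw
      · simp [φ.left_inv (h₀ hw), φ₁.right_inv hw']
  have hinj : Set.InjOn (φ₁ ∘ φ.symm) (φ.symm ⁻¹' S ∩ φ.target) := by
    rintro z ⟨hz, hz'⟩ w ⟨hw, hw'⟩ h
    exact φ.symm.injOn hz' hw' (φ₁.injOn (h₁ hz) (h₁ hw) h)
  have hmeas := measurableSet_chart_symm_preimage x₀ hS
  -- Change of variables: the real Jacobian |τ'|² of the holomorphic transition is exactly the ratio
  -- of the conformal factors.
  rw [← himg, lintegral_image_eq_lintegral_abs_det_fderiv_mul volume hmeas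
    (f' := fun z ↦ (ContinuousLinearMap.toSpanSingleton ℂ
      (transDeriv x₀ x₁ (φ.symm z))).restrictScalars ℝ) ?_ hinj]
  · refine setLIntegral_congr_fun hmeas ?_
    rintro z ⟨hz, hz'⟩
    simp only [det_toSpanSingleton_restrictScalars, Function.comp_apply]
    rw [φ₁.left_inv (h₁ hz), confFactor_change hg (h₀ hz) (h₁ hz), abs_of_nonneg (by positivity),
      ENNReal.ofReal_mul (by positivity)]
  · rintro z ⟨hz, hz'⟩
    have := (hasDerivAt_transition (h₀ hz) (h₁ hz)).hasFDerivAt.restrictScalars ℝ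
    rw [φ.right_inv hz'] at this
    exact this.hasFDerivWithinAt

/-- Any other patch measure, cut down to this patch, lives on an overlap, where it agrees with this
one. The supremum thus adds nothing inside the patch. -/
theorem areaMeasure_restrict {g : SurfaceMetric M} (hg : IsConformal g) (x₀ : M) :
    (areaMeasure g).restrict (chartAt ℂ x₀).source = patchMeasure g x₀ := by
  set U := (chartAt ℂ x₀).source
  have hU : MeasurableSet U := (chartAt ℂ x₀).open_source.measurableSet
  have hle : ∀ x, (patchMeasure g x).restrict U ≤ patchMeasure g x₀ := by
    intro x
    refine Measure.le_iff.2 fun S hS ↦ ?_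
    have hV : MeasurableSet (chartAt ℂ x).source := (chartAt ℂ x).open_source.measurableSet
    rw [Measure.restrict_apply hS, ← patchMeasure_restrict_source g x,
      Measure.restrict_apply (hS.inter hU),
      patchMeasure_congr hg ((hS.inter hU).inter hV) Set.inter_subset_right
        (Set.inter_subset_left.trans Set.inter_subset_right) (x₁ := x₀)]
    exact measure_mono (Set.inter_subset_left.trans Set.inter_subset_left)
  have hall : areaMeasure g ≤ patchMeasure g x₀ + (areaMeasure g).restrict Uᶜ := by
    refine iSup_le fun x ↦ ?_
    change patchMeasure g x ≤ _
    rw [← Measure.restrict_add_restrict_compl (μ := patchMeasure g x) hU]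
    exact add_le_add (hle x) (Measure.restrict_mono subset_rfl (patchMeasure_le g x))
  apply le_antisymm
  · refine (Measure.restrict_mono subset_rfl hall).trans ?_
    rw [Measure.restrict_add, Measure.restrict_restrict hU, Set.inter_compl_self,
      Measure.restrict_empty, add_zero]
    exact Measure.restrict_le_self
  · rw [← patchMeasure_restrict_source]
    exact Measure.restrict_mono subset_rfl (patchMeasure_le g x₀)

theorem isFiniteMeasure_areaMeasure [CompactSpace M] {g : SurfaceMetric M} (hg : IsConformal g) :
    IsFiniteMeasure (areaMeasure g) := by
  have : IsLocallyFiniteMeasure (areaMeasure g) := by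
    refine ⟨fun x ↦ ?_⟩
    set φ := chartAt ℂ x
    have hx : φ x ∈ φ.target := mem_chart_target ℂ x
    obtain ⟨K, hKc, hK, hKt⟩ := exists_compact_subset φ.open_target hx
    have hV : φ.source ∩ φ ⁻¹' (interior K) ∈ 𝓝 x :=
      (φ.isOpen_inter_preimage isOpen_interior).mem_nhds
        ⟨mem_chart_source ℂ x, hK⟩
    refine ⟨_, hV, ?_⟩
    have hm : MeasurableSet (φ.source ∩ φ ⁻¹' (interior K)) :=
      (φ.isOpen_inter_preimage isOpen_interior).measurableSet
    rw [← Set.inter_self φ.source, Set.inter_assoc, Set.inter_comm, ← Measure.restrict_apply hm,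
      areaMeasure_restrict hg, patchMeasure_apply _ _ hm]
    -- Each point has a neighbourhood inside a compact coordinate set, where the conformal factor is
    -- bounded; compactness of the surface does the rest.
    obtain ⟨C, hC⟩ := hKc.exists_bound_of_continuousOn
      ((continuousOn_confFactor_symm g x).mono hKt)
    have hsub : φ.symm ⁻¹' (φ.source ∩ φ ⁻¹' interior K) ∩ φ.target ⊆ K := by
      rintro z ⟨⟨-, hz⟩, hz'⟩
      rw [Set.mem_preimage, φ.right_inv hz'] at hz
      exact interior_subset hz
    calc _ ≤ ∫⁻ z in φ.symm ⁻¹' (φ.source ∩ φ ⁻¹' interior K) ∩ φ.target, ENNReal.ofReal C :=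
          setLIntegral_mono' (measurableSet_chart_symm_preimage x hm) fun z hz ↦
            ENNReal.ofReal_le_ofReal ((le_abs_self _).trans (hC z (hsub hz)))
      _ ≤ ∫⁻ z in K, ENNReal.ofReal C := lintegral_mono_set hsub
      _ < (⊤ : ℝ≥0∞) := by
          rw [setLIntegral_const]
          exact ENNReal.mul_lt_top ENNReal.ofReal_lt_top hKc.measure_lt_top
  infer_instance

/-- Integration of a continuous function over a coordinate patch. -/
theorem setIntegral_areaMeasure {g : SurfaceMetric M} (hg : IsConformal g) (x₀ : M) {f : M → ℝ}
    (hf : Continuous f) :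
    ∫ x in (chartAt ℂ x₀).source, f x ∂(areaMeasure g) =
      ∫ z in (chartAt ℂ x₀).target, confFactor g x₀ ((chartAt ℂ x₀).symm z) *
        f ((chartAt ℂ x₀).symm z) := by
  have ht := (chartAt ℂ x₀).open_target.measurableSet
  rw [areaMeasure_restrict hg, patchMeasure, integral_map
    ((aemeasurable_chart_symm x₀).mono_ac (withDensity_absolutelyContinuous _ _))
    hf.aestronglyMeasurable, integral_withDensity_eq_integral_toReal_smul₀]
  · refine setIntegral_congr_fun ht fun z hz ↦ ?_
    simp only [smul_eq_mul]
    rw [ENNReal.toReal_ofReal (confFactor_pos g ((chartAt ℂ x₀).map_target hz)).le]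
  · exact ((continuousOn_confFactor_symm g x₀).aemeasurable ht).ennreal_ofReal
  · simp

end Measure

/-! ### Stokes' theorem on the closed surface. -/

section Stokes

theorem integral_fderiv_eq_zero {f : ℂ → ℝ} (hf : ContDiff ℝ ∞ f) (hs : HasCompactSupport f)
    (v : ℂ) : Integrable (fun z ↦ fderiv ℝ f z v) ∧ ∫ z, fderiv ℝ f z v = 0 := by
  have hi : Integrable (fun z ↦ fderiv ℝ f z v) :=
    ((hf.continuous_fderiv (by simp)).clm_apply continuous_const).integrable_of_hasCompactSupport
      ((hs.fderiv (𝕜 := ℝ)).comp_left (g := fun L : ℂ →L[ℝ] ℝ ↦ L v) rfl)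
  refine ⟨hi, ?_⟩
  have h := integral_mul_fderiv_eq_neg_fderiv_mul_of_integrable (μ := (volume : Measure ℂ))
    (f := fun _ ↦ (1 : ℝ)) (g := f) (v := v) (by simp) (by simpa using hi)
    (by simpa using hf.continuous.integrable_of_hasCompactSupport hs)
    (fun _ _ ↦ differentiableAt_const _) (fun _ _ ↦ hf.differentiable (by simp) _)
  simpa using h

variable {M : Type*} [TopologicalSpace M] [ChartedSpace ℂ M]

theorem contDiffOn_comp_chart_symm [IsManifold 𝓘(ℝ, ℂ) ∞ M] {E : Type*} [NormedAddCommGroup E]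
    [NormedSpace ℝ E] {f : M → E} {x₀ : M}
    (hf : ContMDiffOn 𝓘(ℝ, ℂ) 𝓘(ℝ, E) ∞ f (chartAt ℂ x₀).source) :
    ContDiffOn ℝ ∞ (f ∘ (chartAt ℂ x₀).symm) (chartAt ℂ x₀).target := by
  rw [← contMDiffOn_iff_contDiffOn]
  exact hf.comp (contMDiffOn_chart_symm (I := 𝓘(ℝ, ℂ))) (chartAt ℂ x₀).mapsTo_symm

variable [IsManifold 𝓘(ℝ, ℂ) ∞ M]

/-- The product of a function and a 1-form. -/
def OneForm.mulFun (f : M → ℝ) (A : OneForm M) : OneForm M := fun x ↦ f x • A x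

theorem coeff_mulFun (f : M → ℝ) (A : OneForm M) (x₀ : M) (v : ℂ) :
    coeff (A.mulFun f) x₀ v = (f ∘ (chartAt ℂ x₀).symm) * coeff A x₀ v := rfl

theorem OneForm.IsSmooth.mulFun {f : M → ℝ} (hf : ContMDiff 𝓘(ℝ, ℂ) 𝓘(ℝ, ℝ) ∞ f) {A : OneForm M}
    (hA : A.IsSmooth) : (A.mulFun f).IsSmooth := fun x₀ v ↦
  (contDiffOn_comp_chart_symm hf.contMDiffOn).mul (hA x₀ v)

theorem coeff_sum {ι : Type*} (s : Finset ι) (A : ι → OneForm M) (x₀ : M) (v : ℂ) :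
    coeff (fun x ↦ ∑ i ∈ s, A i x) x₀ v = ∑ i ∈ s, coeff (A i) x₀ v := by
  ext z
  simp only [coeff, Finset.sum_apply]
  rw [sum_apply]

theorem curl_sum (g : SurfaceMetric M) {ι : Type*} (s : Finset ι) {A : ι → OneForm M}
    (hA : ∀ i, (A i).IsSmooth) (x : M) :
    curl g (fun x ↦ ∑ i ∈ s, A i x) x = ∑ i ∈ s, curl g (A i) x := by
  have h : ∀ v, ∀ i ∈ s, DifferentiableAt ℝ (coeff (A i) x v) (chartAt ℂ x x) :=
    fun v i _ ↦ (hA i).differentiableAt_coeff v (mem_chart_target ℂ x)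
  simp only [curl]
  rw [coeff_sum, coeff_sum, fderiv_sum (h _), fderiv_sum (h _)]
  simp only [sum_apply, ← Finset.sum_sub_distrib, Finset.mul_sum]

theorem curl_eq_zero_of_eventually (g : SurfaceMetric M) {A : OneForm M} {x : M}
    (h : ∀ᶠ y in 𝓝 x, A y = 0) : curl g A x = 0 := by
  have hc : ∀ v, coeff A x v =ᶠ[𝓝 (chartAt ℂ x x)] fun _ ↦ 0 := by
    intro v
    have ht := ((chartAt ℂ x).continuousAt_symm (mem_chart_target ℂ x)).tendsto
    rw [(chartAt ℂ x).left_inv (mem_chart_source ℂ x)] at ht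
    filter_upwards [ht.eventually h] with z hz
    rw [coeff, hz]
    rfl
  simp [curl, (hc _).fderiv_eq]

variable [IsManifold 𝓘(ℂ, ℂ) ω M]

/-- `curl` at each point uses that point's own chart, so continuity is visible only after rewriting
it in one fixed chart. -/
theorem continuous_curl {g : SurfaceMetric M} (hg : IsConformal g) {A : OneForm M}
    (hA : A.IsSmooth) : Continuous (curl g A) := by
  refine continuous_iff_continuousAt.2 fun x ↦ ?_
  have hx := mem_chart_source ℂ x
  have hev : (fun y ↦ (confFactor g x y)⁻¹ *
      (fderiv ℝ (coeff A x Complex.I) (chartAt ℂ x y) 1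
        - fderiv ℝ (coeff A x 1) (chartAt ℂ x y) Complex.I)) =ᶠ[𝓝 x] curl g A := by
    filter_upwards [(chartAt ℂ x).open_source.mem_nhds hx] with y hy
    exact (curl_eq hg hA hy).symm
  refine ContinuousAt.congr ?_ hev
  have hd : ∀ v w, ContinuousAt (fun y ↦ fderiv ℝ (coeff A x v) (chartAt ℂ x y) w) x := by
    intro v w
    have h1 : ContDiffAt ℝ ∞ (coeff A x v) (chartAt ℂ x x) :=
      (hA x v).contDiffAt ((chartAt ℂ x).open_target.mem_nhds (mem_chart_target ℂ x))
    have h2 : ContinuousAt (fderiv ℝ (coeff A x v)) (chartAt ℂ x x) :=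
      (h1.fderiv_right (m := 0) (by simp)).continuousAt
    exact (ContinuousAt.comp (f := chartAt ℂ x) h2
      ((chartAt ℂ x).continuousAt hx)).clm_apply continuousAt_const
  exact ((contMDiffAt_confFactor g hx).continuousAt.inv₀ (confFactor_pos g hx).ne').mul
    ((hd _ _).sub (hd _ _))

variable [T2Space M] [MeasurableSpace M] [BorelSpace M]

theorem integral_curl_of_support {g : SurfaceMetric M} (hg : IsConformal g) {A : OneForm M}
    (hA : A.IsSmooth) {x₀ : M} {K : Set M} (hK : IsCompact K) (hKs : K ⊆ (chartAt ℂ x₀).source)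
    (h0 : ∀ x ∉ K, A x = 0) : ∫ x, curl g A x ∂(areaMeasure g) = 0 := by
  set φ := chartAt ℂ x₀
  have hKc : IsCompact (φ '' K) := hK.image_of_continuousOn (φ.continuousOn.mono hKs)
  have hKt : φ '' K ⊆ φ.target := Set.image_subset_iff.2 fun x hx ↦ φ.map_source (hKs hx)
  have hcoeff0 : ∀ v, ∀ z ∈ φ.target, z ∉ φ '' K → coeff A x₀ v z = 0 := by
    intro v z hz hzK
    have : A (φ.symm z) = 0 := h0 _ fun h ↦ hzK ⟨_, h, φ.right_inv hz⟩
    change A (φ.symm z) _ = 0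
    rw [this]
    rfl
  -- Extension by zero turns the coefficients into smooth compactly supported functions on the whole
  -- plane, whose derivatives integrate to zero.
  set f : ℂ → ℂ → ℝ := fun v ↦ φ.target.indicator (coeff A x₀ v) with hf
  have hf0 : ∀ v, ∀ z ∉ φ '' K, f v z = 0 := by
    intro v z hz
    by_cases hzt : z ∈ φ.target
    · rw [hf]
      simp only [Set.indicator_of_mem hzt]
      exact hcoeff0 v z hzt hz
    · exact Set.indicator_of_notMem hzt _
  have hfs : ∀ v, ContDiff ℝ ∞ (f v) := by
    refine fun v ↦ contDiff_iff_contDiffAt.2 fun z ↦ ?_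
    by_cases hz : z ∈ φ '' K
    · have hzt := φ.open_target.mem_nhds (hKt hz)
      refine ((hA x₀ v).contDiffAt hzt).congr_of_eventuallyEq ?_
      filter_upwards [hzt] with w hw using Set.indicator_of_mem hw _
    · refine (contDiffAt_const (c := (0 : ℝ))).congr_of_eventuallyEq ?_
      filter_upwards [hKc.isClosed.isOpen_compl.mem_nhds hz] with w hw using hf0 v w hw
  have hfc : ∀ v, HasCompactSupport (f v) := fun v ↦ HasCompactSupport.intro hKc (hf0 v)
  have hU : MeasurableSet φ.source := φ.open_source.measurableSet
  have hcurl0 : ∀ x ∉ φ.source, curl g A x = 0 := by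
    intro x hx
    refine curl_eq_zero_of_eventually g ?_
    filter_upwards [hK.isClosed.isOpen_compl.mem_nhds fun h ↦ hx (hKs h)] with y hy using h0 y hy
  rw [← setIntegral_eq_integral_of_forall_compl_eq_zero hcurl0,
    setIntegral_areaMeasure hg x₀ (continuous_curl hg hA)]
  have hfd : ∀ v, ∀ z ∈ φ.target, fderiv ℝ (coeff A x₀ v) z = fderiv ℝ (f v) z := by
    intro v z hz
    refine Filter.EventuallyEq.fderiv_eq ?_
    filter_upwards [φ.open_target.mem_nhds hz] with w hw using (Set.indicator_of_mem hw _).symm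
  have hint : ∫ z in φ.target, confFactor g x₀ (φ.symm z) * curl g A (φ.symm z)
      = ∫ z in φ.target, (fderiv ℝ (f Complex.I) z 1 - fderiv ℝ (f 1) z Complex.I) := by
    refine setIntegral_congr_fun φ.open_target.measurableSet fun z hz ↦ ?_
    rw [curl_eq hg hA (φ.map_target hz), φ.right_inv hz, ← mul_assoc,
      mul_inv_cancel₀ (confFactor_pos g (φ.map_target hz)).ne', one_mul, hfd _ z hz, hfd _ z hz]
  rw [hint, setIntegral_eq_integral_of_forall_compl_eq_zero]
  · obtain ⟨h1, h2⟩ := integral_fderiv_eq_zero (hfs Complex.I) (hfc _) 1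
    obtain ⟨h3, h4⟩ := integral_fderiv_eq_zero (hfs 1) (hfc _) Complex.I
    rw [integral_sub h1 h3, h2, h4, sub_zero]
  · intro z hz
    have : ∀ v, fderiv ℝ (f v) z = 0 := by
      intro v
      have : f v =ᶠ[𝓝 z] fun _ ↦ 0 := by
        filter_upwards [hKc.isClosed.isOpen_compl.mem_nhds fun h ↦ hz (hKt h)] with w hw
          using hf0 v w hw
      simp [this.fderiv_eq]
    simp [this]

/-- Stokes' theorem on the closed surface. -/
theorem integral_curl [CompactSpace M] {g : SurfaceMetric M} (hg : IsConformal g) {A : OneForm M}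
    (hA : A.IsSmooth) : ∫ x, curl g A x ∂(areaMeasure g) = 0 := by
  obtain ⟨t, ht⟩ := isCompact_univ.elim_finite_subcover (fun x : M ↦ (chartAt ℂ x).source)
    (fun x ↦ (chartAt ℂ x).open_source) fun x _ ↦ Set.mem_iUnion.2 ⟨x, mem_chart_source ℂ x⟩
  obtain ⟨ρ, hρ⟩ := SmoothPartitionOfUnity.exists_isSubordinate 𝓘(ℝ, ℂ) isClosed_univ
    (fun i : t ↦ (chartAt ℂ (i : M)).source) (fun i ↦ (chartAt ℂ (i : M)).open_source)
    (by simpa [Set.iUnion_subtype] using ht)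
  have hfin := isFiniteMeasure_areaMeasure hg
  have hsm : ∀ i, (A.mulFun (ρ i)).IsSmooth := fun i ↦ hA.mulFun (ρ i).contMDiff
  have hsum : A = fun x ↦ ∑ i, A.mulFun (ρ i) x := by
    ext1 x
    have := ρ.sum_eq_one (Set.mem_univ x)
    rw [finsum_eq_sum_of_fintype] at this
    simp only [OneForm.mulFun, ← Finset.sum_smul, this, one_smul]
  have hcurl : ∀ x, curl g A x = ∑ i, curl g (A.mulFun (ρ i)) x := fun x ↦ by
    conv_lhs => rw [hsum]
    exact curl_sum g _ hsm x
  simp only [hcurl]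
  rw [integral_finsetSum]
  · refine Finset.sum_eq_zero fun i _ ↦ integral_curl_of_support hg (hsm i)
      (isClosed_tsupport (ρ i)).isCompact (hρ i) fun x hx ↦ ?_
    simp [OneForm.mulFun, image_eq_zero_of_notMem_tsupport hx]
  · exact fun i _ ↦ (continuous_curl hg (hsm i)).integrable_of_hasCompactSupport
      (HasCompactSupport.of_compactSpace _)

end Stokes

/-! ### Local sections, unitary connections and the current Im ⟨s, ∇s⟩. -/

section Bundle

variable {M : Type*} [TopologicalSpace M] [ChartedSpace ℂ M]

theorem fderiv_comp_chart_symm {E : Type*} [NormedAddCommGroup E] [NormedSpace ℝ E] {f : M → E}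
    {x : M} (hf : MDifferentiableAt 𝓘(ℝ, ℂ) 𝓘(ℝ, E) f x) (v : ℂ) :
    fderiv ℝ (f ∘ (chartAt ℂ x).symm) (chartAt ℂ x x) v = mfderiv 𝓘(ℝ, ℂ) 𝓘(ℝ, E) f x v := by
  simp only [mfderiv, hf, writtenInExtChartAt]
  simp [fderivWithin_univ]
  rfl

variable [IsManifold 𝓘(ℝ, ℂ) ∞ M]
  {L : M → Type*} [∀ x, NormedAddCommGroup (L x)] [∀ x, InnerProductSpace ℂ (L x)]
  [TopologicalSpace (TotalSpace ℂ L)] [FiberBundle ℂ L]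

/-- The section `s` is smooth at `x`. -/
abbrev SmoothSectionAt (s : Π x, L x) (x : M) : Prop :=
  ContMDiffAt 𝓘(ℝ, ℂ) (𝓘(ℝ, ℂ).prod 𝓘(ℝ, ℂ)) ∞ (fun y ↦ TotalSpace.mk' ℂ y (s y)) x

omit [IsManifold 𝓘(ℝ, ℂ) ∞ M] [∀ x, InnerProductSpace ℂ (L x)] in
theorem IsSmoothSection.eventually {s : Π x, L x} (hs : IsSmoothSection s) (x : M) :
    ∀ᶠ y in 𝓝 x, SmoothSectionAt s y :=
  Eventually.of_forall fun y ↦ hs.contMDiffAt (x := y)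

variable [VectorBundle ℝ ℂ L] [T2Space M]

/-- The axioms on connections and Hermitian metrics speak of global smooth sections, while ∇s along
a coordinate field is smooth only on a patch. A bump function supplies a global section with the
same germ. -/
theorem exists_isSmoothSection_eventuallyEq [ContMDiffVectorBundle ∞ ℂ L 𝓘(ℝ, ℂ)]
    {s : Π x, L x} {x : M} (hs : ∀ᶠ y in 𝓝 x, SmoothSectionAt s y) :
    ∃ s' : Π x, L x, IsSmoothSection s' ∧ ∀ᶠ y in 𝓝 x, s' y = s y := by
  obtain ⟨U, hU, hUo, hxU⟩ := eventually_nhds_iff.1 hs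
  obtain ⟨f, -, hf⟩ := (SmoothBumpFunction.nhds_basis_tsupport (I := 𝓘(ℝ, ℂ)) x).mem_iff.1
    (hUo.mem_nhds hxU)
  refine ⟨fun y ↦ f y • s y, ?_, ?_⟩
  · exact ContMDiffOn.smul_section_of_tsupport (u := U) f.contMDiff.contMDiffOn hUo hf
      fun y hy ↦ (hU y hy).contMDiffWithinAt
  · filter_upwards [f.eventuallyEq_one] with y hy
    simp [hy]

theorem exists_isSmoothSection_ne_zero [ContMDiffVectorBundle ∞ ℂ L 𝓘(ℝ, ℂ)]
    (x : M) : ∃ s : Π x, L x, IsSmoothSection s ∧ s x ≠ 0 := by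
  set e := trivializationAt ℂ L x
  have hx : x ∈ e.baseSet := mem_baseSet_trivializationAt ℂ L x
  have h := e.continuousLinearEquivAt ℝ x hx
  have hs : ∀ᶠ y in 𝓝 x, SmoothSectionAt (FiberBundle.extend ℂ (h.symm 1)) y := by
    obtain ⟨V, hV, hs⟩ := FiberBundle.exists_contMDiffOn_extend 𝓘(ℝ, ℂ) ℂ (k := ∞) (h.symm 1)
    filter_upwards [eventually_mem_nhds_iff.2 hV] with y hy using hs.contMDiffAt hy
  obtain ⟨s', hs', hev⟩ := exists_isSmoothSection_eventuallyEq hs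
  refine ⟨s', hs', ?_⟩
  rw [hev.self_of_nhds, FiberBundle.extend_apply_self]
  simp


theorem IsSmoothHermitian.contMDiffAt_inner [ContMDiffVectorBundle ∞ ℂ L 𝓘(ℝ, ℂ)]
    (hL : IsSmoothHermitian L) {s t : Π x, L x} {x : M} (hs : ∀ᶠ y in 𝓝 x, SmoothSectionAt s y)
    (ht : ∀ᶠ y in 𝓝 x, SmoothSectionAt t y) :
    ContMDiffAt 𝓘(ℝ, ℂ) 𝓘(ℝ, ℂ) ∞ (fun y ↦ inner ℂ (s y) (t y)) x := by
  obtain ⟨s', hs', hse⟩ := exists_isSmoothSection_eventuallyEq hs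
  obtain ⟨t', ht', hte⟩ := exists_isSmoothSection_eventuallyEq ht
  refine (hL s' t' hs' ht').contMDiffAt.congr_of_eventuallyEq ?_
  filter_upwards [hse, hte] with y h1 h2
  rw [h1, h2]

theorem IsSmoothHermitian.contMDiff_norm_sq (hL : IsSmoothHermitian L) {s : Π x, L x}
    (hs : IsSmoothSection s) : ContMDiff 𝓘(ℝ, ℂ) 𝓘(ℝ, ℝ) ∞ (fun y ↦ ‖s y‖ ^ 2) := by
  have h := Complex.reCLM.contMDiff.comp (hL s s hs hs)
  refine h.congr fun y ↦ ?_
  simp [inner_self_eq_norm_sq_to_K, ← Complex.ofReal_pow]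

variable [VectorBundle ℂ ℂ L] {cov : CovariantDerivative 𝓘(ℝ, ℂ) ℂ L}

theorem cov_congr (cov : CovariantDerivative 𝓘(ℝ, ℂ) ℂ L) {s t : Π x, L x} {x : M}
    (hs : SmoothSectionAt s x) (ht : SmoothSectionAt t x) (h : ∀ᶠ y in 𝓝 x, s y = t y) :
    cov s x = cov t x :=
  cov.isCovariantDerivativeOnUniv.congr_of_eventuallyEq (hs.mdifferentiableAt (by simp))
    (ht.mdifferentiableAt (by simp)) univ_mem h

variable [ContMDiffVectorBundle ∞ ℂ L 𝓘(ℝ, ℂ)]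

theorem IsUnitaryConnection.mfderiv_inner (hcov : IsUnitaryConnection cov) {s t : Π x, L x} {x : M}
    (hs : ∀ᶠ y in 𝓝 x, SmoothSectionAt s y) (ht : ∀ᶠ y in 𝓝 x, SmoothSectionAt t y)
    (v : TangentSpace 𝓘(ℝ, ℂ) x) :
    mfderiv 𝓘(ℝ, ℂ) 𝓘(ℝ, ℂ) (fun y ↦ inner ℂ (s y) (t y)) x v
      = (inner ℂ (cov s x v) (t x) + inner ℂ (s x) (cov t x v) : ℂ) := by
  obtain ⟨s', hs', hse⟩ := exists_isSmoothSection_eventuallyEq hs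
  obtain ⟨t', ht', hte⟩ := exists_isSmoothSection_eventuallyEq ht
  rw [← cov_congr cov hs'.contMDiffAt hs.self_of_nhds hse,
    ← cov_congr cov ht'.contMDiffAt ht.self_of_nhds hte, ← hse.self_of_nhds, ← hte.self_of_nhds,
    ← hcov.metric s' t' hs' ht']
  have : (fun y ↦ inner ℂ (s y) (t y)) =ᶠ[𝓝 x] (fun y ↦ inner ℂ (s' y) (t' y)) := by
    filter_upwards [hse, hte] with y h1 h2
    rw [h1, h2]
  exact congrArg (fun l : TangentSpace 𝓘(ℝ, ℂ) x →L[ℝ] ℂ ↦ l v) this.mfderiv_eq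

theorem IsUnitaryConnection.smoothSectionAt_cov (hcov : IsUnitaryConnection cov) {s : Π x, L x}
    (hs : IsSmoothSection s) {x₀ y : M} (hy : y ∈ (chartAt ℂ x₀).source) (v : ℂ) :
    SmoothSectionAt (fun p ↦ cov s p (coordVec x₀ v p)) y := by
  have h := hcov.smooth.contMDiff.contMDiff (σ := s) (hs.contMDiffOn (s := Set.univ))
  have h1 := (h y (Set.mem_univ y)).contMDiffAt univ_mem
  exact h1.clm_bundle_apply (contMDiffAt_coordVec hy v)

theorem IsUnitaryConnection.eventually_smoothSectionAt_cov (hcov : IsUnitaryConnection cov)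
    {s : Π x, L x} (hs : IsSmoothSection s) {x₀ y : M} (hy : y ∈ (chartAt ℂ x₀).source) (v : ℂ) :
    ∀ᶠ p in 𝓝 y, SmoothSectionAt (fun p ↦ cov s p (coordVec x₀ v p)) p := by
  filter_upwards [(chartAt ℂ x₀).open_source.mem_nhds hy] with p hp
  exact hcov.smoothSectionAt_cov hs hp v

/-- The 1-form `Im ⟨s, ∇s⟩`. -/
def current (cov : CovariantDerivative 𝓘(ℝ, ℂ) ℂ L) (s : Π x, L x) : OneForm M := fun x ↦
  Complex.imCLM ∘L ((innerSL ℂ (s x)).restrictScalars ℝ) ∘L cov s x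

omit [T2Space M] [ContMDiffVectorBundle ∞ ℂ L 𝓘(ℝ, ℂ)] in
theorem current_apply (s : Π x, L x) (x : M) (v : TangentSpace 𝓘(ℝ, ℂ) x) :
    current cov s x v = (inner ℂ (s x) (cov s x v)).im := rfl

theorem contMDiffAt_inner_cov (hL : IsSmoothHermitian L) (hcov : IsUnitaryConnection cov)
    {s : Π x, L x} (hs : IsSmoothSection s) {x₀ y : M} (hy : y ∈ (chartAt ℂ x₀).source) (v : ℂ) :
    ContMDiffAt 𝓘(ℝ, ℂ) 𝓘(ℝ, ℂ) ∞ (fun p ↦ inner ℂ (s p) (cov s p (coordVec x₀ v p))) y :=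
  hL.contMDiffAt_inner (hs.eventually y) (hcov.eventually_smoothSectionAt_cov hs hy v)

theorem isSmooth_current (hL : IsSmoothHermitian L) (hcov : IsUnitaryConnection cov)
    {s : Π x, L x} (hs : IsSmoothSection s) : (current cov s).IsSmooth := by
  intro x₀ v
  have h : ContMDiffOn 𝓘(ℝ, ℂ) 𝓘(ℝ, ℂ) ∞ (fun p ↦ inner ℂ (s p) (cov s p (coordVec x₀ v p)))
      (chartAt ℂ x₀).source :=
    fun y hy ↦ (contMDiffAt_inner_cov hL hcov hs hy v).contMDiffWithinAt
  exact Complex.imCLM.contDiff.comp_contDiffOn (contDiffOn_comp_chart_symm h)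

/-- `*d Im ⟨s, ∇s⟩ = 2 e^{-2ρ} Im ⟨∇₁ s, ∇₂ s⟩ - B |s|²`. -/
theorem curl_current (hL : IsSmoothHermitian L) {g : SurfaceMetric M}
    (hcov : IsUnitaryConnection cov) {B : M → ℝ} (hB : HasCurvature g cov B)
    {s : Π x, L x} (hs : IsSmoothSection s) (x : M) :
    curl g (current cov s) x = (confFactor g x x)⁻¹ *
      (2 * (inner ℂ (cov s x (coordVec x 1 x)) (cov s x (coordVec x Complex.I x))).im)
        - B x * ‖s x‖ ^ 2 := by
  have hx := mem_chart_source ℂ x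
  have key : ∀ v w : ℂ, fderiv ℝ (coeff (current cov s) x v) (chartAt ℂ x x) w =
      (inner ℂ (cov s x (coordVec x w x)) (cov s x (coordVec x v x))
        + inner ℂ (s x) (cov (fun p ↦ cov s p (coordVec x v p)) x (coordVec x w x))).im := by
    intro v w
    have hd : MDifferentiableAt 𝓘(ℝ, ℂ) 𝓘(ℝ, ℂ)
        (fun p ↦ inner ℂ (s p) (cov s p (coordVec x v p))) x :=
      (contMDiffAt_inner_cov hL hcov hs hx v).mdifferentiableAt (by simp)
    have hdf : DifferentiableAt ℝ ((fun p ↦ inner ℂ (s p) (cov s p (coordVec x v p))) ∘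
        (chartAt ℂ x).symm) (chartAt ℂ x x) := by
      have h : ContMDiffOn 𝓘(ℝ, ℂ) 𝓘(ℝ, ℂ) ∞ (fun p ↦ inner ℂ (s p) (cov s p (coordVec x v p)))
          (chartAt ℂ x).source :=
        fun y hy ↦ (contMDiffAt_inner_cov hL hcov hs hy v).contMDiffWithinAt
      exact ((contDiffOn_comp_chart_symm h).contDiffAt
        ((chartAt ℂ x).open_target.mem_nhds (mem_chart_target ℂ x))).differentiableAt (by simp)
    have h1 := hcov.mfderiv_inner (hs.eventually x)
      (hcov.eventually_smoothSectionAt_cov hs hx v) (coordVec x w x)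
    have h2 := fderiv_comp_chart_symm hd w
    rw [coordVec_self w] at h1 ⊢
    rw [← h1]
    have h3 : fderiv ℝ (coeff (current cov s) x v) (chartAt ℂ x x) =
        Complex.imCLM ∘L fderiv ℝ ((fun p ↦ inner ℂ (s p) (cov s p (coordVec x v p))) ∘
          (chartAt ℂ x).symm) (chartAt ℂ x x) :=
      (Complex.imCLM.hasFDerivAt.comp _ hdf.hasFDerivAt).fderiv
    rw [h3]
    exact congrArg Complex.im h2
  -- Pairing with s turns the commutator of second covariant derivatives left over in the curl into
  -- -B e^{2ρ} |s|².
  have hcurv := congrArg (fun u ↦ (inner ℂ (s x) u).im) (hB s hs x x hx)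
  have hpos := confFactor_pos g hx
  rw [curl, key, key]
  simp only [inner_sub_right, inner_smul_right, Complex.sub_im] at hcurv
  have hss : inner ℂ (s x) (s x) = ((‖s x‖ ^ 2 : ℝ) : ℂ) := by
    rw [inner_self_eq_norm_sq_to_K]; simp
  rw [hss] at hcurv
  have hconj : (inner ℂ (cov s x (coordVec x Complex.I x)) (cov s x (coordVec x 1 x))).im
      = -(inner ℂ (cov s x (coordVec x 1 x)) (cov s x (coordVec x Complex.I x))).im := by
    rw [← inner_conj_symm, Complex.conj_im]
  simp only [Complex.add_im, hconj]
  have : (-Complex.I * (B x : ℂ) * (confFactor g x x : ℂ) * ((‖s x‖ ^ 2 : ℝ) : ℂ)).im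
      = -(B x * confFactor g x x * ‖s x‖ ^ 2) := by
    rw [show -Complex.I * (B x : ℂ) * (confFactor g x x : ℂ) * ((‖s x‖ ^ 2 : ℝ) : ℂ)
      = -(((B x * confFactor g x x * ‖s x‖ ^ 2 : ℝ) : ℂ) * Complex.I) by push_cast; ring,
      Complex.neg_im, Complex.im_ofReal_mul, Complex.I_im, mul_one]
  rw [this] at hcurv
  field_simp
  linear_combination hcurv

end Bundle

/-! ### Pointwise algebra of the weighted Bogomolny inequality. -/

section Algebra

variable {E : Type*} [NormedAddCommGroup E] [InnerProductSpace ℂ E]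

/-- The terms quadratic in a₁, a₂ vanish because ⟨u, u⟩ is real. -/
theorem im_inner_sub_smul (P Q u : E) (a₁ a₂ : ℝ) :
    (inner ℂ (P - a₁ • Complex.I • u) (Q - a₂ • Complex.I • u)).im =
      (inner ℂ P Q).im - a₂ * (inner ℂ u P).re + a₁ * (inner ℂ u Q).re := by
  have h1 : inner ℂ P u = (starRingEnd ℂ) (inner ℂ u P) := (inner_conj_symm _ _).symm
  have h2 : (inner ℂ u u).im = 0 := inner_self_im (𝕜 := ℂ) u
  simp only [← Complex.coe_smul, inner_sub_left, inner_sub_right, inner_smul_left,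
    inner_smul_right, h1]
  generalize inner ℂ u u = z at *
  generalize inner ℂ u P = p at *
  simp [h2]
  ring

theorem two_mul_im_inner_le (P Q : E) : 2 * (inner ℂ P Q).im ≤ ‖P‖ ^ 2 + ‖Q‖ ^ 2 := by
  have h := (Complex.abs_im_le_norm _).trans (norm_inner_le_norm (𝕜 := ℂ) P Q)
  nlinarith [le_abs_self (inner ℂ P Q).im, sq_nonneg (‖P‖ - ‖Q‖)]

/-- In a complex line P = p u and Q = q u, and both sides are |u|⁴ Im (p̄ q). It converts d|s|² ∧ Im
⟨s, ∇s⟩ into a multiple of Im ⟨∇₁ s, ∇₂ s⟩. -/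
theorem re_mul_im_sub_of_finrank_eq_one (hE : Module.finrank ℂ E = 1) (P Q u : E) :
    (inner ℂ u P).re * (inner ℂ u Q).im - (inner ℂ u Q).re * (inner ℂ u P).im =
      ‖u‖ ^ 2 * (inner ℂ P Q).im := by
  rcases eq_or_ne u 0 with rfl | hu
  · simp
  obtain ⟨p, rfl⟩ := exists_smul_eq_of_finrank_eq_one hE hu P
  obtain ⟨q, rfl⟩ := exists_smul_eq_of_finrank_eq_one hE hu Q
  have hss : inner ℂ u u = ((‖u‖ ^ 2 : ℝ) : ℂ) := by
    rw [inner_self_eq_norm_sq_to_K]; simp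
  simp only [inner_smul_left, inner_smul_right, hss]
  generalize ‖u‖ ^ 2 = S
  simp
  ring

/-- Here u = s, P = ∇₁ s, Q = ∇₂ s, k = e^{-2ρ} and c = `*da`; the left side is the curl of the
weighted current expanded by the product rule. It equals (h + S h') times 2k Im ⟨D₁ s, D₂ s⟩, minus
h S (b + c), where S = |s|² and h = (1 + εS)⁻¹. -/
theorem weighted_bogomolny_le (hE : Module.finrank ℂ E = 1) (P Q u : E) (a₁ a₂ b c : ℝ) {k ε : ℝ}
    (hk : 0 ≤ k) (hε : 0 ≤ ε) :
    (1 + ε * ‖u‖ ^ 2)⁻¹ * (k * (2 * (inner ℂ P Q).im) - b * ‖u‖ ^ 2 - (‖u‖ ^ 2 * c +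
      k * (2 * (inner ℂ u P).re * a₂ - 2 * (inner ℂ u Q).re * a₁))) +
      k * (-((1 + ε * ‖u‖ ^ 2) ^ 2)⁻¹ * (ε * (2 * (inner ℂ u P).re)) *
          ((inner ℂ u Q).im - ‖u‖ ^ 2 * a₂) -
        -((1 + ε * ‖u‖ ^ 2) ^ 2)⁻¹ * (ε * (2 * (inner ℂ u Q).re)) *
          ((inner ℂ u P).im - ‖u‖ ^ 2 * a₁))
      ≤ ((1 + ε * ‖u‖ ^ 2) ^ 2)⁻¹ *
          (k * (‖P - a₁ • Complex.I • u‖ ^ 2 + ‖Q - a₂ • Complex.I • u‖ ^ 2)) -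
        (b + c) * (‖u‖ ^ 2 * (1 + ε * ‖u‖ ^ 2)⁻¹) := by
  have h1 := re_mul_im_sub_of_finrank_eq_one hE P Q u
  have h2 := two_mul_im_inner_le (P - a₁ • Complex.I • u) (Q - a₂ • Complex.I • u)
  rw [im_inner_sub_smul] at h2
  set S := ‖u‖ ^ 2
  have hS : 0 ≤ S := by positivity
  have hne : 1 + ε * S ≠ 0 := by positivity
  have hh : 0 ≤ ((1 + ε * S) ^ 2)⁻¹ * k := by positivity
  have h3 := mul_le_mul_of_nonneg_left h2 hh
  -- Over the common factor w = (1 + εS)⁻² the coefficient h + S h' becomes w ((1 + εS) - εS) = w,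
  -- which is nonnegative.
  have h4 : (1 + ε * S)⁻¹ = ((1 + ε * S) ^ 2)⁻¹ * (1 + ε * S) := by field_simp
  rw [h4]
  generalize ((1 + ε * S) ^ 2)⁻¹ = w at *
  linear_combination h3 - 2 * w * k * ε * h1

end Algebra

/-! ### Product rule and linearity for the curl. -/

section Product

variable {M : Type*} [TopologicalSpace M] [ChartedSpace ℂ M] [IsManifold 𝓘(ℝ, ℂ) ∞ M]

/-- The derivative of the function `f` along the tangent vector `v` at `x`. -/
def dirDeriv (f : M → ℝ) (x : M) (v : TangentSpace 𝓘(ℝ, ℂ) x) : ℝ :=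
  mfderiv 𝓘(ℝ, ℂ) 𝓘(ℝ, ℝ) f x v

theorem curl_mulFun (g : SurfaceMetric M) {f : M → ℝ} (hf : ContMDiff 𝓘(ℝ, ℂ) 𝓘(ℝ, ℝ) ∞ f)
    {A : OneForm M} (hA : A.IsSmooth) (x : M) :
    curl g (A.mulFun f) x = f x * curl g A x + (confFactor g x x)⁻¹ *
      (dirDeriv f x (coordVec x 1 x) * A x (coordVec x Complex.I x) -
        dirDeriv f x (coordVec x Complex.I x) * A x (coordVec x 1 x)) := by
  have hfd : MDifferentiableAt 𝓘(ℝ, ℂ) 𝓘(ℝ, ℝ) f x := hf.contMDiffAt.mdifferentiableAt (by simp)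
  have hfs : DifferentiableAt ℝ (f ∘ (chartAt ℂ x).symm) (chartAt ℂ x x) :=
    ((contDiffOn_comp_chart_symm hf.contMDiffOn).contDiffAt
      ((chartAt ℂ x).open_target.mem_nhds (mem_chart_target ℂ x))).differentiableAt (by simp)
  have key : ∀ v w : ℂ, fderiv ℝ (coeff (A.mulFun f) x v) (chartAt ℂ x x) w =
      f x * fderiv ℝ (coeff A x v) (chartAt ℂ x x) w
        + A x (coordVec x v x) * fderiv ℝ (f ∘ (chartAt ℂ x).symm) (chartAt ℂ x x) w := by
    intro v w
    rw [coeff_mulFun, fderiv_mul hfs (hA.differentiableAt_coeff v (mem_chart_target ℂ x))]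
    have hs : (chartAt ℂ x).symm (chartAt ℂ x x) = x :=
      (chartAt ℂ x).left_inv (mem_chart_source ℂ x)
    have hc : coeff A x v (chartAt ℂ x x) = A x (coordVec x v x) := by rw [coeff, hs]
    simp [hc, hs]
  have e1 : fderiv ℝ (f ∘ (chartAt ℂ x).symm) (chartAt ℂ x x) 1 =
      dirDeriv f x (coordVec x 1 x) := by
    rw [coordVec_self]
    exact fderiv_comp_chart_symm hfd 1
  have e2 : fderiv ℝ (f ∘ (chartAt ℂ x).symm) (chartAt ℂ x x) Complex.I =
      dirDeriv f x (coordVec x Complex.I x) := by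
    rw [coordVec_self]
    exact fderiv_comp_chart_symm hfd Complex.I
  rw [curl, curl, key, key, e1, e2]
  ring

theorem coeff_sub (A B : OneForm M) (x₀ : M) (v : ℂ) :
    coeff (A - B) x₀ v = coeff A x₀ v - coeff B x₀ v := rfl

theorem OneForm.IsSmooth.sub {A B : OneForm M} (hA : A.IsSmooth) (hB : B.IsSmooth) :
    OneForm.IsSmooth (A - B) := fun x₀ v ↦ (hA x₀ v).sub (hB x₀ v)

theorem curl_sub (g : SurfaceMetric M) {A B : OneForm M} (hA : A.IsSmooth) (hB : B.IsSmooth)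
    (x : M) : curl g (A - B) x = curl g A x - curl g B x := by
  have hd := fun v ↦ hA.differentiableAt_coeff v (mem_chart_target ℂ x)
  have hd' := fun v ↦ hB.differentiableAt_coeff v (mem_chart_target ℂ x)
  rw [curl, coeff_sub, coeff_sub, fderiv_sub (hd _) (hd' _), fderiv_sub (hd _) (hd' _), curl, curl]
  simp only [sub_apply]
  ring

end Product

/-! ### The weighted current and its curl. -/

section Weighted

variable {M : Type*} [TopologicalSpace M] [ChartedSpace ℂ M] [IsManifold 𝓘(ℝ, ℂ) ∞ M] [T2Space M]
  {L : M → Type*} [∀ x, NormedAddCommGroup (L x)] [∀ x, InnerProductSpace ℂ (L x)]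
  [TopologicalSpace (TotalSpace ℂ L)] [FiberBundle ℂ L] [VectorBundle ℂ ℂ L]
  [VectorBundle ℝ ℂ L] [ContMDiffVectorBundle ∞ ℂ L 𝓘(ℝ, ℂ)]
  {cov : CovariantDerivative 𝓘(ℝ, ℂ) ℂ L}

theorem finrank_fiber (x : M) : Module.finrank ℂ (L x) = 1 := by
  have h := (trivializationAt ℂ L x).continuousLinearEquivAt ℂ x
    (mem_baseSet_trivializationAt ℂ L x)
  rw [h.toLinearEquiv.finrank_eq, Module.finrank_self]

theorem dirDeriv_comp {f : M → ℝ} {x : M} (hf : MDifferentiableAt 𝓘(ℝ, ℂ) 𝓘(ℝ, ℝ) f x)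
    {F : ℝ → ℝ} {d : ℝ} (hF : HasDerivAt F d (f x)) (v : TangentSpace 𝓘(ℝ, ℂ) x) :
    dirDeriv (fun y ↦ F (f y)) x v = d * dirDeriv f x v := by
  have h := (hF.hasFDerivAt.hasMFDerivAt.comp x hf.hasMFDerivAt).mfderiv
  have h2 := congrArg (fun l : TangentSpace 𝓘(ℝ, ℂ) x →L[ℝ] ℝ ↦ l v) h
  refine h2.trans ?_
  exact mul_comm _ _

theorem IsUnitaryConnection.dirDeriv_norm_sq (hL : IsSmoothHermitian L)
    (hcov : IsUnitaryConnection cov) {s : Π x, L x} (hs : IsSmoothSection s) (x : M)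
    (v : TangentSpace 𝓘(ℝ, ℂ) x) :
    dirDeriv (fun y ↦ ‖s y‖ ^ 2) x v = 2 * (inner ℂ (s x) (cov s x v)).re := by
  have h := hcov.metric s s hs hs x v
  have h1 : MDifferentiableAt 𝓘(ℝ, ℂ) 𝓘(ℝ, ℂ) (fun y ↦ inner ℂ (s y) (s y)) x :=
    (hL s s hs hs).contMDiffAt.mdifferentiableAt (by simp)
  have h2 := (Complex.reCLM.hasFDerivAt.hasMFDerivAt.comp x h1.hasMFDerivAt).mfderiv
  have he : (Complex.reCLM ∘ fun y ↦ inner ℂ (s y) (s y)) = fun y ↦ ‖s y‖ ^ 2 := by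
    ext y
    simp [inner_self_eq_norm_sq_to_K, ← Complex.ofReal_pow]
  rw [he] at h2
  have h3 := congrArg (fun l : TangentSpace 𝓘(ℝ, ℂ) x →L[ℝ] ℝ ↦ l v) h2
  have h4 : dirDeriv (fun y ↦ ‖s y‖ ^ 2) x v =
      (inner ℂ (cov s x v) (s x) + inner ℂ (s x) (cov s x v)).re := h3.trans (congrArg Complex.re h)
  rw [h4, Complex.add_re, ← inner_conj_symm (cov s x v), Complex.conj_re, two_mul]

/-- The magnetic current `(1 + ε |s|²)⁻¹ (Im ⟨s, ∇s⟩ - a |s|²)`. -/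
def weightedCurrent (cov : CovariantDerivative 𝓘(ℝ, ℂ) ℂ L) (a : OneForm M) (s : Π x, L x)
    (ε : ℝ) : OneForm M :=
  OneForm.mulFun (fun x ↦ (1 + ε * ‖s x‖ ^ 2)⁻¹) (current cov s - a.mulFun fun x ↦ ‖s x‖ ^ 2)

theorem contMDiff_weight (hL : IsSmoothHermitian L) {s : Π x, L x} (hs : IsSmoothSection s) {ε : ℝ}
    (hε : 0 ≤ ε) : ContMDiff 𝓘(ℝ, ℂ) 𝓘(ℝ, ℝ) ∞ (fun x ↦ (1 + ε * ‖s x‖ ^ 2)⁻¹) := by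
  intro x
  have h : ContDiffAt ℝ ∞ (fun t : ℝ ↦ (1 + ε * t)⁻¹) (‖s x‖ ^ 2) :=
    ContDiffAt.inv (by fun_prop) (by positivity)
  exact ContMDiffAt.comp (f := fun x ↦ ‖s x‖ ^ 2) x h.contMDiffAt (hL.contMDiff_norm_sq hs).contMDiffAt

theorem isSmooth_weightedCurrent (hL : IsSmoothHermitian L) (hcov : IsUnitaryConnection cov)
    {a : OneForm M} (ha : a.IsSmooth) {s : Π x, L x} (hs : IsSmoothSection s) {ε : ℝ}
    (hε : 0 ≤ ε) : (weightedCurrent cov a s ε).IsSmooth :=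
  ((isSmooth_current hL hcov hs).sub (ha.mulFun (hL.contMDiff_norm_sq hs))).mulFun
    (contMDiff_weight hL hs hε)

theorem curl_mulFun_norm_sq (hL : IsSmoothHermitian L) {g : SurfaceMetric M}
    (hcov : IsUnitaryConnection cov) {a : OneForm M} (ha : a.IsSmooth) {s : Π x, L x}
    (hs : IsSmoothSection s) (x : M) :
    curl g (a.mulFun fun x ↦ ‖s x‖ ^ 2) x = ‖s x‖ ^ 2 * curl g a x + (confFactor g x x)⁻¹ *
      (2 * (inner ℂ (s x) (cov s x (coordVec x 1 x))).re * a x (coordVec x Complex.I x) -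
        2 * (inner ℂ (s x) (cov s x (coordVec x Complex.I x))).re * a x (coordVec x 1 x)) :=
  by rw [curl_mulFun g (hL.contMDiff_norm_sq hs) ha, hcov.dirDeriv_norm_sq hL hs,
    hcov.dirDeriv_norm_sq hL hs]

omit [T2Space M] [ContMDiffVectorBundle ∞ ℂ L 𝓘(ℝ, ℂ)] in
theorem covDeriv_apply (A : OneForm M) (Φ : Π x, L x)
    (ψ : Π x, TangentSpace 𝓘(ℝ, ℂ) x →L[ℝ] L x) (x : M) (v : TangentSpace 𝓘(ℝ, ℂ) x) :
    covDeriv A Φ ψ x v = ψ x v - A x v • Complex.I • Φ x := rfl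

omit [T2Space M] [ContMDiffVectorBundle ∞ ℂ L 𝓘(ℝ, ℂ)] in
theorem formNorm_sq_fiber {g : SurfaceMetric M} (hg : IsConformal g) [IsManifold 𝓘(ℂ, ℂ) ω M]
    {x₀ y : M} (h₀ : y ∈ (chartAt ℂ x₀).source) (ψ : TangentSpace 𝓘(ℝ, ℂ) y →L[ℝ] L y) :
    formNorm g y ψ ^ 2 = (confFactor g x₀ y)⁻¹ *
      (‖ψ (coordVec x₀ 1 y)‖ ^ 2 + ‖ψ (coordVec x₀ Complex.I y)‖ ^ 2) :=
  letI : ∀ x, InnerProductSpace ℝ (L x) := fun x ↦ InnerProductSpace.rclikeToReal ℂ (L x)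
  formNorm_sq (V := L) hg h₀ ψ

/-- The pointwise Bogomolny inequality, with the weight `(1 + ε |s|²)⁻¹`. -/
theorem curl_weightedCurrent_le (hL : IsSmoothHermitian L) {g : SurfaceMetric M}
    (hg : IsConformal g) [IsManifold 𝓘(ℂ, ℂ) ω M]
    (hcov : IsUnitaryConnection cov) {b : ℝ} (hb : HasCurvature g cov fun _ ↦ b) {a : OneForm M}
    (ha : a.IsSmooth) {s : Π x, L x} (hs : IsSmoothSection s) {ε : ℝ} (hε : 0 ≤ ε) (x : M) :
    curl g (weightedCurrent cov a s ε) x ≤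
      ((1 + ε * ‖s x‖ ^ 2) ^ 2)⁻¹ * formNorm g x (covDeriv a s (cov s) x) ^ 2 -
        (b + curl g a x) * (‖s x‖ ^ 2 * (1 + ε * ‖s x‖ ^ 2)⁻¹) := by
  have hd : HasDerivAt (fun t : ℝ ↦ (1 + ε * t)⁻¹) (-((1 + ε * ‖s x‖ ^ 2) ^ 2)⁻¹ * ε)
      (‖s x‖ ^ 2) := by
    have h := (((hasDerivAt_id (‖s x‖ ^ 2)).const_mul ε).const_add 1).inv
      (by simp only [id_eq]; positivity)
    refine h.congr_deriv ?_
    simp only [id_eq]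
    field_simp
  have hms : MDifferentiableAt 𝓘(ℝ, ℂ) 𝓘(ℝ, ℝ) (fun y ↦ ‖s y‖ ^ 2) x :=
    (hL.contMDiff_norm_sq hs).contMDiffAt.mdifferentiableAt (by simp)
  have hmf : ∀ v, dirDeriv (fun y ↦ (1 + ε * ‖s y‖ ^ 2)⁻¹) x v =
      -((1 + ε * ‖s x‖ ^ 2) ^ 2)⁻¹ * ε * (2 * (inner ℂ (s x) (cov s x v)).re) := fun v ↦ by
    rw [dirDeriv_comp hms hd v, hcov.dirDeriv_norm_sq hL hs x v]
  have hJ := isSmooth_current hL hcov hs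
  have hJa := ha.mulFun (hL.contMDiff_norm_sq hs)
  rw [weightedCurrent, curl_mulFun g (contMDiff_weight hL hs hε) (hJ.sub hJa), hmf, hmf,
    curl_sub g hJ hJa, curl_current hL hcov hb hs, curl_mulFun_norm_sq hL hcov ha hs,
    formNorm_sq_fiber hg (mem_chart_source ℂ x)]
  refine le_trans (le_of_eq ?_) (weighted_bogomolny_le (finrank_fiber x)
    (cov s x (coordVec x 1 x)) (cov s x (coordVec x Complex.I x)) (s x) (a x (coordVec x 1 x))
    (a x (coordVec x Complex.I x)) b (curl g a x)
    (inv_nonneg.2 (confFactor_pos g (mem_chart_source ℂ x)).le) hε)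
  have e : ∀ v, (current cov s - a.mulFun fun x ↦ ‖s x‖ ^ 2) x v =
      (inner ℂ (s x) (cov s x v)).im - ‖s x‖ ^ 2 * a x v := fun v ↦ rfl
  rw [e, e]
  ring

end Weighted

/-! ### Skew-Hermitian variations in a complex line. -/

section Algebra

variable {E : Type*} [NormedAddCommGroup E] [InnerProductSpace ℂ E]

/-- The first identity makes t' = e t with e imaginary, and the second forces the same multiplier on
s. Applied to the difference of two unitary connections, it produces one real coefficient for all
sections. -/
theorem eq_smul_I_smul_of_skew (hE : Module.finrank ℂ E = 1) {s t s' t' : E} (ht : t ≠ 0)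
    (h₁ : inner ℂ t' t + inner ℂ t t' = 0) (h₂ : inner ℂ s' t + inner ℂ s t' = 0) :
    s' = ((‖t‖ ^ 2)⁻¹ * (inner ℂ t t').im) • Complex.I • s := by
  obtain ⟨c, rfl⟩ := exists_smul_eq_of_finrank_eq_one hE ht s
  obtain ⟨k, rfl⟩ := exists_smul_eq_of_finrank_eq_one hE ht s'
  obtain ⟨e, rfl⟩ := exists_smul_eq_of_finrank_eq_one hE ht t'
  have htt : inner ℂ t t = ((‖t‖ ^ 2 : ℝ) : ℂ) := by
    rw [inner_self_eq_norm_sq_to_K]; simp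
  have hT : ‖t‖ ^ 2 ≠ 0 := by simpa using ht
  simp only [inner_smul_left, inner_smul_right, htt] at h₁ h₂ ⊢
  generalize ‖t‖ ^ 2 = T at *
  have hT' : (T : ℂ) ≠ 0 := by exact_mod_cast hT
  have h₃ : (starRingEnd ℂ) e = -e := by
    have : ((starRingEnd ℂ) e + e) * T = 0 := by linear_combination h₁
    linear_combination (mul_eq_zero.1 this).resolve_right hT'
  have h₄ : (starRingEnd ℂ) k = -((starRingEnd ℂ) c * e) := by
    have : ((starRingEnd ℂ) k + (starRingEnd ℂ) c * e) * T = 0 := by linear_combination h₂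
    linear_combination (mul_eq_zero.1 this).resolve_right hT'
  have h₅ : k = c * e := by
    have := congrArg (starRingEnd ℂ) h₄
    simpa [h₃] using this
  have h₆ : (e.im : ℂ) * Complex.I = e := by
    have : e.re = 0 := by
      have := congrArg Complex.re h₃
      simp at this
      linarith
    apply Complex.ext <;> simp [this]
  have h₇ : T⁻¹ * (e * (T : ℂ)).im = e.im := by
    rw [Complex.im_mul_ofReal]
    field_simp
  rw [h₇, ← Complex.coe_smul, smul_smul, smul_smul, h₅]
  congr 1
  linear_combination (-c) * h₆

theorem norm_sub_smul_I_smul_sq (P u : E) (a : ℝ) :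
    ‖P - a • Complex.I • u‖ ^ 2 =
      ‖P‖ ^ 2 - 2 * a * (inner ℂ u P).im + a ^ 2 * ‖u‖ ^ 2 := by
  rw [← Complex.coe_smul, norm_sub_sq (𝕜 := ℂ), inner_smul_right, inner_smul_right,
    norm_smul, norm_smul]
  have h : (inner ℂ P u).im = -(inner ℂ u P).im := by rw [← inner_conj_symm, Complex.conj_im]
  simp [mul_pow, h]
  ring

end Algebra

/-! ### Independence of the degree from the connection. -/

section Degree

variable {M : Type*} [TopologicalSpace M] [ChartedSpace ℂ M] [IsManifold 𝓘(ℝ, ℂ) ∞ M] [T2Space M]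
  {L : M → Type*} [∀ x, NormedAddCommGroup (L x)] [∀ x, InnerProductSpace ℂ (L x)]
  [TopologicalSpace (TotalSpace ℂ L)] [FiberBundle ℂ L] [VectorBundle ℂ ℂ L]
  [VectorBundle ℝ ℂ L] [ContMDiffVectorBundle ∞ ℂ L 𝓘(ℝ, ℂ)]
  {cov cov' : CovariantDerivative 𝓘(ℝ, ℂ) ℂ L}

theorem IsUnitaryConnection.difference_apply (hcov : IsUnitaryConnection cov)
    (hcov' : IsUnitaryConnection cov') {s t : Π x, L x} (hs : IsSmoothSection s)
    (ht : IsSmoothSection t) {x : M} (htx : t x ≠ 0) (v : TangentSpace 𝓘(ℝ, ℂ) x) :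
    cov' s x v = cov s x v -
      ((‖t x‖ ^ 2)⁻¹ * (current cov t x v - current cov' t x v)) • Complex.I • s x := by
  have key : ∀ {p q : Π x, L x}, IsSmoothSection p → IsSmoothSection q →
      inner ℂ (cov' p x v - cov p x v) (q x) + inner ℂ (p x) (cov' q x v - cov q x v) = 0 := by
    intro p q hp hq
    have h := (hcov.metric p q hp hq x v).symm.trans (hcov'.metric p q hp hq x v)
    rw [inner_sub_left, inner_sub_right]
    have h' : inner ℂ (cov p x v) (q x) + inner ℂ (p x) (cov q x v) =
      inner ℂ (cov' p x v) (q x) + inner ℂ (p x) (cov' q x v) := h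
    linear_combination -h'
  have h := eq_smul_I_smul_of_skew (finrank_fiber x) htx (key ht ht) (key hs ht)
  rw [inner_sub_right, Complex.sub_im] at h
  rw [current_apply, current_apply, ← neg_sub (inner ℂ (t x) (cov' t x v)).im, mul_neg, neg_smul,
    sub_neg_eq_add, ← h]
  abel

theorem exists_difference_form (hL : IsSmoothHermitian L) (hcov : IsUnitaryConnection cov)
    (hcov' : IsUnitaryConnection cov') : ∃ α : OneForm M, α.IsSmooth ∧
      ∀ s : Π x, L x, IsSmoothSection s → ∀ x v,
        cov' s x v = cov s x v - α x v • Complex.I • s x := by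
  choose τ hτ hτ0 using fun x : M ↦ exists_isSmoothSection_ne_zero (L := L) x
  set α : OneForm M := fun x ↦
    (‖τ x x‖ ^ 2)⁻¹ • (current cov (τ x) x - current cov' (τ x) x) with hα
  have hdiff : ∀ s : Π x, L x, IsSmoothSection s → ∀ x v,
      cov' s x v = cov s x v - α x v • Complex.I • s x :=
    fun s hs x v ↦ hcov.difference_apply hcov' hs (hτ x) (hτ0 x) v
  -- Any section that does not vanish at x computes the same α x. Near y the single section `τ y`
  -- can therefore be used, which makes α smooth although `τ` was chosen pointwise.
  have hα' : ∀ (t : Π x, L x), IsSmoothSection t → ∀ x, t x ≠ 0 →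
      α x = (‖t x‖ ^ 2)⁻¹ • (current cov t x - current cov' t x) := by
    intro t ht x htx
    ext v
    have h1 := hdiff t ht x v
    have h2 := hcov.difference_apply hcov' ht ht htx v
    have h3 := sub_right_injective (h1.symm.trans h2)
    exact smul_left_injective ℝ (smul_ne_zero Complex.I_ne_zero htx) h3
  refine ⟨α, fun x₀ v z hz ↦ ?_, hdiff⟩
  set φ := chartAt ℂ x₀
  set y := φ.symm z with hy
  have hn := hL.contMDiff_norm_sq (hτ y)
  have hev : coeff α x₀ v =ᶠ[𝓝 z] fun w ↦ ((fun p ↦ ‖τ y p‖ ^ 2) ∘ φ.symm) w ^ (-1 : ℤ) *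
      (coeff (current cov (τ y)) x₀ v w - coeff (current cov' (τ y)) x₀ v w) := by
    have h1 : ∀ᶠ p in 𝓝 y, ‖τ y p‖ ^ 2 ≠ 0 :=
      hn.continuous.continuousAt.eventually_ne (by simpa using hτ0 y)
    filter_upwards [(φ.continuousAt_symm hz).eventually h1] with w hw
    have h2 := hα' (τ y) (hτ y) (φ.symm w) (by simpa using hw)
    change α (φ.symm w) _ = _
    rw [h2, zpow_neg_one]
    rfl
  have hzt := φ.open_target.mem_nhds hz
  have hd : ContDiffAt ℝ ∞ ((fun p ↦ ‖τ y p‖ ^ 2) ∘ φ.symm) z :=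
    (contDiffOn_comp_chart_symm hn.contMDiffOn).contDiffAt hzt
  have hd' : ContDiffAt ℝ ∞ (fun w ↦ ((fun p ↦ ‖τ y p‖ ^ 2) ∘ φ.symm) w ^ (-1 : ℤ)) z := by
    simp only [zpow_neg_one]
    exact hd.inv (by simpa using hτ0 y)
  exact ((hd'.mul (((isSmooth_current hL hcov (hτ y) x₀ v).contDiffAt hzt).sub
    ((isSmooth_current hL hcov' (hτ y) x₀ v).contDiffAt hzt))).congr_of_eventuallyEq
      hev).contDiffWithinAt

/-- The two currents of s differ by α |s|². Comparing their curls through `curl_current` and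
dividing by |s|² isolates the curvatures. -/
theorem curvature_difference (hL : IsSmoothHermitian L) {g : SurfaceMetric M}
    (hcov : IsUnitaryConnection cov) (hcov' : IsUnitaryConnection cov') {B B' : M → ℝ}
    (hB : HasCurvature g cov B) (hB' : HasCurvature g cov' B') {α : OneForm M} (hα : α.IsSmooth)
    (h : ∀ s : Π x, L x, IsSmoothSection s → ∀ x v,
      cov' s x v = cov s x v - α x v • Complex.I • s x) (x : M) :
    B' x = B x + curl g α x := by
  obtain ⟨s, hs, hsx⟩ := exists_isSmoothSection_ne_zero (L := L) x
  have hJ : current cov' s = current cov s - α.mulFun fun x ↦ ‖s x‖ ^ 2 := by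
    ext y v
    change (inner ℂ (s y) (cov' s y v)).im = (inner ℂ (s y) (cov s y v)).im - ‖s y‖ ^ 2 * α y v
    rw [h s hs, ← Complex.coe_smul, inner_sub_right, inner_smul_right, inner_smul_right,
      inner_self_eq_norm_sq_to_K]
    simp [← Complex.ofReal_pow, mul_comm]
  have h1 := curl_current hL hcov' hB' hs x
  rw [hJ, curl_sub g (isSmooth_current hL hcov hs) (hα.mulFun (hL.contMDiff_norm_sq hs)),
    curl_current hL hcov hB hs, curl_mulFun_norm_sq hL hcov hα hs, h s hs, h s hs,
    im_inner_sub_smul] at h1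
  have hne : ‖s x‖ ^ 2 ≠ 0 := by simpa using hsx
  apply mul_right_cancel₀ hne
  linear_combination h1

variable [IsManifold 𝓘(ℂ, ℂ) ω M] [CompactSpace M] [MeasurableSpace M] [BorelSpace M]

theorem integrable_of_continuous {g : SurfaceMetric M} (hg : IsConformal g) {f : M → ℝ}
    (hf : Continuous f) : Integrable f (areaMeasure g) :=
  have := isFiniteMeasure_areaMeasure hg
  hf.integrable_of_hasCompactSupport (HasCompactSupport.of_compactSpace _)

/-- A connection of constant curvature `-i b dμ_g` on a bundle of degree `N`: `b |Σ| = 2 π N`. -/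
theorem curvature_mul_area (hL : IsSmoothHermitian L) {g : SurfaceMetric M} (hg : IsConformal g)
    (hcov : IsUnitaryConnection cov) {b : ℝ} (hb : HasCurvature g cov fun _ ↦ b) {N : ℤ}
    (hN : HasDegree g L N) : b * area g = 2 * Real.pi * N := by
  obtain ⟨cov', B', hcov', hB', -, hint⟩ := hN
  obtain ⟨α, hα, h⟩ := exists_difference_form hL hcov hcov'
  have := isFiniteMeasure_areaMeasure hg
  have hB : B' = fun x ↦ b + curl g α x := by
    ext x
    exact curvature_difference hL hcov hcov' hb hB' hα h x
  rw [← hint, hB, integral_add (integrable_const b)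
    (integrable_of_continuous hg (continuous_curl hg hα)), integral_curl hg hα, integral_const,
    smul_eq_mul, add_zero, mul_comm]
  rfl

end Degree

/-! ### Continuity of the densities and the integrated inequality for smooth fields. -/

section Smooth

variable {M : Type*} [TopologicalSpace M] [ChartedSpace ℂ M] [IsManifold 𝓘(ℝ, ℂ) ∞ M] [T2Space M]
  {L : M → Type*} [∀ x, NormedAddCommGroup (L x)] [∀ x, InnerProductSpace ℂ (L x)]
  [TopologicalSpace (TotalSpace ℂ L)] [FiberBundle ℂ L] [VectorBundle ℂ ℂ L]
  [VectorBundle ℝ ℂ L] [ContMDiffVectorBundle ∞ ℂ L 𝓘(ℝ, ℂ)]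
  {cov : CovariantDerivative 𝓘(ℝ, ℂ) ℂ L} [IsManifold 𝓘(ℂ, ℂ) ω M]

theorem OneForm.IsSmooth.continuousAt_coordVec {a : OneForm M} (ha : a.IsSmooth) {x₀ y : M}
    (hy : y ∈ (chartAt ℂ x₀).source) (v : ℂ) :
    ContinuousAt (fun p ↦ a p (coordVec x₀ v p)) y := by
  have h : ContinuousOn (fun p ↦ coeff a x₀ v (chartAt ℂ x₀ p)) (chartAt ℂ x₀).source :=
    (ha x₀ v).continuousOn.comp (chartAt ℂ x₀).continuousOn (chartAt ℂ x₀).mapsTo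
  have hs := (chartAt ℂ x₀).open_source.mem_nhds hy
  refine (h.continuousAt hs).congr ?_
  filter_upwards [hs] with p hp
  rw [coeff, (chartAt ℂ x₀).left_inv hp]

theorem continuous_formNorm_sq {g : SurfaceMetric M} (hg : IsConformal g) {a : OneForm M}
    (ha : a.IsSmooth) : Continuous fun x ↦ formNorm (V := fun _ ↦ ℝ) g x (a x) ^ 2 := by
  refine continuous_iff_continuousAt.2 fun x ↦ ?_
  have hx := mem_chart_source ℂ x
  have hev : (fun y ↦ (confFactor g x y)⁻¹ *
      (‖a y (coordVec x 1 y)‖ ^ 2 + ‖a y (coordVec x Complex.I y)‖ ^ 2)) =ᶠ[𝓝 x]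
        fun y ↦ formNorm (V := fun _ ↦ ℝ) g y (a y) ^ 2 := by
    filter_upwards [(chartAt ℂ x).open_source.mem_nhds hx] with y hy
    exact (formNorm_sq (V := fun _ ↦ ℝ) hg hy (a y)).symm
  refine ContinuousAt.congr ?_ hev
  exact ((contMDiffAt_confFactor g hx).continuousAt.inv₀ (confFactor_pos g hx).ne').mul
    (((ha.continuousAt_coordVec hx 1).norm.pow 2).add
      ((ha.continuousAt_coordVec hx Complex.I).norm.pow 2))

theorem continuous_formNorm_sq_covDeriv (hL : IsSmoothHermitian L) {g : SurfaceMetric M}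
    (hg : IsConformal g) (hcov : IsUnitaryConnection cov) {a : OneForm M} (ha : a.IsSmooth)
    {s : Π x, L x} (hs : IsSmoothSection s) :
    Continuous fun x ↦ formNorm g x (covDeriv a s (cov s) x) ^ 2 := by
  refine continuous_iff_continuousAt.2 fun x ↦ ?_
  have hx := mem_chart_source ℂ x
  have hev : (fun y ↦ (confFactor g x y)⁻¹ *
      (‖covDeriv a s (cov s) y (coordVec x 1 y)‖ ^ 2 +
        ‖covDeriv a s (cov s) y (coordVec x Complex.I y)‖ ^ 2)) =ᶠ[𝓝 x]
        fun y ↦ formNorm g y (covDeriv a s (cov s) y) ^ 2 := by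
    filter_upwards [(chartAt ℂ x).open_source.mem_nhds hx] with y hy
    exact (formNorm_sq_fiber hg hy _).symm
  refine ContinuousAt.congr ?_ hev
  have hc : ∀ v, ContinuousAt (fun y ↦ ‖covDeriv a s (cov s) y (coordVec x v y)‖ ^ 2) x := by
    intro v
    simp only [covDeriv_apply, norm_sub_smul_I_smul_sq]
    have hP := hcov.eventually_smoothSectionAt_cov hs hx v
    have h1 := Complex.continuous_re.continuousAt.comp (hL.contMDiffAt_inner hP hP).continuousAt
    have h1' : ContinuousAt (fun y ↦ ‖cov s y (coordVec x v y)‖ ^ 2) x := by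
      refine h1.congr (Eventually.of_forall fun y ↦ ?_)
      simp [inner_self_eq_norm_sq_to_K, ← Complex.ofReal_pow]
    have h2 := Complex.continuous_im.continuousAt.comp
      (contMDiffAt_inner_cov hL hcov hs hx v).continuousAt
    have h3 := ha.continuousAt_coordVec hx v
    exact (h1'.sub ((continuousAt_const.mul h3).mul h2)).add
      ((h3.pow 2).mul (hL.contMDiff_norm_sq hs).continuous.continuousAt)
  exact ((contMDiffAt_confFactor g hx).continuousAt.inv₀ (confFactor_pos g hx).ne').mul
    ((hc 1).add (hc Complex.I))

variable [CompactSpace M] [MeasurableSpace M] [BorelSpace M]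

/-- The integrated weighted Bogomolny inequality for smooth fields. -/
theorem integral_weighted_le (hL : IsSmoothHermitian L) {g : SurfaceMetric M}
    (hg : IsConformal g) (hcov : IsUnitaryConnection cov) {b : ℝ}
    (hb : HasCurvature g cov fun _ ↦ b) {a : OneForm M} (ha : a.IsSmooth) {s : Π x, L x}
    (hs : IsSmoothSection s) {ε : ℝ} (hε : 0 ≤ ε) :
    ∫ x, (b + curl g a x) * (‖s x‖ ^ 2 * (1 + ε * ‖s x‖ ^ 2)⁻¹) ∂(areaMeasure g) ≤
      ∫ x, ((1 + ε * ‖s x‖ ^ 2) ^ 2)⁻¹ * formNorm g x (covDeriv a s (cov s) x) ^ 2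
        ∂(areaMeasure g) := by
  have hW := isSmooth_weightedCurrent hL hcov ha hs hε
  have hn := (hL.contMDiff_norm_sq hs).continuous
  have hw := (contMDiff_weight hL hs hε).continuous
  have h1 : Integrable (fun x ↦ (b + curl g a x) * (‖s x‖ ^ 2 * (1 + ε * ‖s x‖ ^ 2)⁻¹))
      (areaMeasure g) :=
    integrable_of_continuous hg ((continuous_const.add (continuous_curl hg ha)).mul (hn.mul hw))
  have h2 : Integrable (fun x ↦ ((1 + ε * ‖s x‖ ^ 2) ^ 2)⁻¹ *
      formNorm g x (covDeriv a s (cov s) x) ^ 2) (areaMeasure g) := by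
    refine integrable_of_continuous hg (Continuous.mul ?_
      (continuous_formNorm_sq_covDeriv hL hg hcov ha hs))
    simp only [← inv_pow]
    exact hw.pow 2
  have h3 := integrable_of_continuous hg (continuous_curl hg hW)
  have h4 := integral_mono h3 (h2.sub h1) (curl_weightedCurrent_le hL hg hcov hb ha hs hε)
  rw [integral_curl hg hW] at h4
  have h5 := integral_sub h2 h1
  simp only [Pi.sub_apply] at h4
  linarith

end Smooth

/-! ### Dominated subsequences of L¹-null sequences. -/

section Subsequence

/-- A sequence converging to zero in `L¹` has a dominated subsequence converging to zero almost
everywhere. -/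
theorem exists_dominated_subseq {X : Type*} [MeasurableSpace X] {μ : Measure X}
    {f : ℕ → X → ℝ≥0∞} (hf : ∀ n, AEMeasurable (f n) μ)
    (h : Tendsto (fun n ↦ ∫⁻ x, f n x ∂μ) atTop (𝓝 0)) :
    ∃ (φ : ℕ → ℕ) (F : X → ℝ≥0∞), AEMeasurable F μ ∧ ∫⁻ x, F x ∂μ ≠ ⊤ ∧
      (∀ n x, f (φ n) x ≤ F x) ∧ ∀ᵐ x ∂μ, Tendsto (fun n ↦ f (φ n) x) atTop (𝓝 0) := by
  -- With integrals at most 2⁻ⁿ, the sum of the selected terms is an integrable majorant, and its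
  -- finiteness almost everywhere forces the terms to zero. The selected indices need not increase.
  have hex : ∀ n : ℕ, ∃ k, ∫⁻ x, f k x ∂μ ≤ (2⁻¹ : ℝ≥0∞) ^ n := fun n ↦
    (h.eventually_le_const (ENNReal.pow_pos (by simp) n)).exists
  choose φ hφ using hex
  have hFm : AEMeasurable (fun x ↦ ∑' n, f (φ n) x) μ := AEMeasurable.tsum fun n ↦ hf (φ n)
  have hF : ∫⁻ x, ∑' n, f (φ n) x ∂μ ≠ ⊤ := by
    rw [lintegral_tsum fun n ↦ hf (φ n)]
    refine ne_top_of_le_ne_top ?_ (ENNReal.tsum_le_tsum hφ)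
    rw [ENNReal.tsum_geometric]
    simp
  refine ⟨φ, fun x ↦ ∑' n, f (φ n) x, hFm, hF, fun n x ↦ ENNReal.le_tsum n, ?_⟩
  filter_upwards [ae_lt_top' hFm hF] with x hx
  exact ENNReal.tendsto_atTop_zero_of_tsum_ne_top hx.ne

end Subsequence

/-! ### Dominated smooth approximation of H¹ fields. -/

section Approximation

variable {M : Type*} [TopologicalSpace M] [ChartedSpace ℂ M] [IsManifold 𝓘(ℝ, ℂ) ∞ M]
  {L : M → Type*} [∀ x, NormedAddCommGroup (L x)] [∀ x, InnerProductSpace ℂ (L x)]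
  [TopologicalSpace (TotalSpace ℂ L)] [FiberBundle ℂ L] [VectorBundle ℂ ℂ L]
  [VectorBundle ℝ ℂ L] {cov : CovariantDerivative 𝓘(ℝ, ℂ) ℂ L}

/-- The squared `H¹` distance density between `(s, a)` and the `H¹` data `(Φ, ψ, A, β)`. -/
def distDensity (g : SurfaceMetric M) (cov : CovariantDerivative 𝓘(ℝ, ℂ) ℂ L) (Φ : Π x, L x)
    (ψ : Π x, TangentSpace 𝓘(ℝ, ℂ) x →L[ℝ] L x) (A : OneForm M) (β : M → ℝ) (s : Π x, L x)
    (a : OneForm M) (x : M) : ℝ :=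
  ‖s x - Φ x‖ ^ 2 + formNorm g x (cov s x - ψ x) ^ 2 +
    formNorm (V := fun _ ↦ ℝ) g x (a x - A x) ^ 2 + (curl g a x - β x) ^ 2

/-- Adding the four squared distances into one density gives a common selection and a common
majorant for section and form. The divergence plays no role in the energy and is dropped. -/
theorem exists_dominated_approximation [MeasurableSpace M] {g : SurfaceMetric M} {Φ : Π x, L x}
    {ψ : Π x, TangentSpace 𝓘(ℝ, ℂ) x →L[ℝ] L x} {A : OneForm M} {β : M → ℝ}
    (hΦ : IsH1Section g cov Φ ψ) (hA : IsH1OneForm g A β) :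
    ∃ (s : ℕ → Π x, L x) (a : ℕ → OneForm M) (F : M → ℝ), (∀ n, IsSmoothSection (s n)) ∧
      (∀ n, (a n).IsSmooth) ∧ Integrable F (areaMeasure g) ∧
      ∀ᵐ x ∂(areaMeasure g), (∀ n, distDensity g cov Φ ψ A β (s n) (a n) x ≤ F x) ∧
        Tendsto (fun n ↦ distDensity g cov Φ ψ A β (s n) (a n) x) atTop (𝓝 0) := by
  obtain ⟨s, hs, ⟨hm₁, ht₁⟩, hm₂, ht₂⟩ := hΦ
  obtain ⟨a, γ, ha, ⟨hm₃, ht₃⟩, ⟨hm₄, ht₄⟩, -⟩ := hA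
  have hf : ∀ n, AEMeasurable (fun x ↦
      ENNReal.ofReal (distDensity g cov Φ ψ A β (s n) (a n) x)) (areaMeasure g) := fun n ↦
    (((((hm₁ n).pow_const 2).add ((hm₂ n).pow_const 2)).add ((hm₃ n).pow_const 2)).add
      ((hm₄ n).pow_const 2)).ennreal_ofReal
  have hlim : Tendsto (fun n ↦ ∫⁻ x, ENNReal.ofReal (distDensity g cov Φ ψ A β (s n) (a n) x)
      ∂(areaMeasure g)) atTop (𝓝 0) := by
    have h := ((ht₁.add ht₂).add ht₃).add ht₄
    simp only [add_zero] at h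
    refine h.congr fun n ↦ ?_
    have e₁ := ((hm₁ n).pow_const 2).ennreal_ofReal
    have e₂ := ((hm₂ n).pow_const 2).ennreal_ofReal
    have e₃ := ((hm₃ n).pow_const 2).ennreal_ofReal
    rw [← lintegral_add_left' e₁]
    erw [← lintegral_add_left' (e₁.add e₂), ← lintegral_add_left' ((e₁.add e₂).add e₃)]
    refine lintegral_congr fun x ↦ ?_
    simp only [Pi.add_apply]
    rw [distDensity, ENNReal.ofReal_add (by positivity) (by positivity),
      ENNReal.ofReal_add (by positivity) (by positivity),
      ENNReal.ofReal_add (by positivity) (by positivity)]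
  obtain ⟨φ, F, hFm, hF, hle, hlim'⟩ := exists_dominated_subseq hf hlim
  refine ⟨s ∘ φ, a ∘ φ, fun x ↦ (F x).toReal, fun n ↦ hs _, fun n ↦ ha _,
    integrable_toReal_of_lintegral_ne_top hFm hF, ?_⟩
  filter_upwards [hlim', ae_lt_top' hFm hF] with x hx hx'
  have hnn : ∀ n, 0 ≤ distDensity g cov Φ ψ A β (s (φ n)) (a (φ n)) x := fun n ↦ by
    rw [distDensity]; positivity
  refine ⟨fun n ↦ (ENNReal.ofReal_le_iff_le_toReal hx'.ne).1 (hle n x), ?_⟩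
  have h := (ENNReal.tendsto_toReal ENNReal.zero_ne_top).comp hx
  refine h.congr fun n ↦ ?_
  simp [ENNReal.toReal_ofReal (hnn n)]

variable [IsManifold 𝓘(ℂ, ℂ) ω M]

theorem formNorm_sq_add_le {V : M → Type*} [∀ x, NormedAddCommGroup (V x)]
    [∀ x, NormedSpace ℝ (V x)] (g : SurfaceMetric M) (x : M)
    (ψ₁ ψ₂ : TangentSpace 𝓘(ℝ, ℂ) x →L[ℝ] V x) :
    formNorm g x (ψ₁ + ψ₂) ^ 2 ≤ 2 * formNorm g x ψ₁ ^ 2 + 2 * formNorm g x ψ₂ ^ 2 := by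
  have hk := inv_pos.2 (confFactor_pos g (mem_chart_source ℂ x))
  simp only [formNorm]
  rw [Real.sq_sqrt (by positivity), Real.sq_sqrt (by positivity), Real.sq_sqrt (by positivity)]
  have h : ∀ v, ‖(ψ₁ + ψ₂) v‖ ^ 2 ≤ 2 * ‖ψ₁ v‖ ^ 2 + 2 * ‖ψ₂ v‖ ^ 2 := fun v ↦ by
    have := norm_add_le (ψ₁ v) (ψ₂ v)
    have h2 := pow_le_pow_left₀ (norm_nonneg _) this 2
    rw [add_apply]
    nlinarith [sq_nonneg (‖ψ₁ v‖ - ‖ψ₂ v‖)]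
  have h3 := mul_le_mul_of_nonneg_left
    (add_le_add (h (coordVec x 1 x)) (h (coordVec x Complex.I x))) hk.le
  linarith

theorem formNorm_neg {V : M → Type*} [∀ x, NormedAddCommGroup (V x)]
    [∀ x, NormedSpace ℝ (V x)] (g : SurfaceMetric M) (x : M)
    (ψ : TangentSpace 𝓘(ℝ, ℂ) x →L[ℝ] V x) : formNorm g x (-ψ) = formNorm g x ψ := by
  simp [formNorm]

theorem formNorm_sq_sub_le {V : M → Type*} [∀ x, NormedAddCommGroup (V x)]
    [∀ x, NormedSpace ℝ (V x)] (g : SurfaceMetric M) (x : M)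
    (ψ₁ ψ₂ : TangentSpace 𝓘(ℝ, ℂ) x →L[ℝ] V x) :
    formNorm g x (ψ₁ - ψ₂) ^ 2 ≤ 2 * formNorm g x ψ₁ ^ 2 + 2 * formNorm g x ψ₂ ^ 2 := by
  rw [sub_eq_add_neg]
  refine (formNorm_sq_add_le g x ψ₁ (-ψ₂)).trans_eq ?_
  rw [formNorm_neg]

/-- If `ψ₀` and `ψ₁` are both at squared distance `≤ F` from `ψ`, then `|ψ₁|²` is controlled. -/
theorem formNorm_sq_le_of_dist {V : M → Type*} [∀ x, NormedAddCommGroup (V x)]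
    [∀ x, NormedSpace ℝ (V x)] (g : SurfaceMetric M) (x : M)
    {ψ ψ₀ ψ₁ : TangentSpace 𝓘(ℝ, ℂ) x →L[ℝ] V x} {F : ℝ} (h₀ : formNorm g x (ψ₀ - ψ) ^ 2 ≤ F)
    (h₁ : formNorm g x (ψ₁ - ψ) ^ 2 ≤ F) :
    formNorm g x ψ₁ ^ 2 ≤ 8 * F + 2 * formNorm g x ψ₀ ^ 2 := by
  have h2 := formNorm_sq_sub_le g x (ψ₁ - ψ) (ψ₀ - ψ)
  have h3 := formNorm_sq_add_le g x (ψ₁ - ψ - (ψ₀ - ψ)) ψ₀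
  rw [show ψ₁ - ψ - (ψ₀ - ψ) + ψ₀ = ψ₁ by abel] at h3
  linarith

theorem formNorm_sq_covDeriv_le (g : SurfaceMetric M) (A : OneForm M) (Φ : Π x, L x)
    (ψ : Π x, TangentSpace 𝓘(ℝ, ℂ) x →L[ℝ] L x) (x : M) :
    formNorm g x (covDeriv A Φ ψ x) ^ 2 ≤ 2 * formNorm g x (ψ x) ^ 2 +
      2 * (‖Φ x‖ ^ 2 * formNorm (V := fun _ ↦ ℝ) g x (A x) ^ 2) := by
  refine (formNorm_sq_sub_le g x (ψ x) ((A x).smulRight (Complex.I • Φ x))).trans_eq ?_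
  have hk := inv_pos.2 (confFactor_pos g (mem_chart_source ℂ x))
  have : formNorm g x ((A x).smulRight (Complex.I • Φ x)) ^ 2 =
      ‖Φ x‖ ^ 2 * formNorm (V := fun _ ↦ ℝ) g x (A x) ^ 2 := by
    simp only [formNorm]
    rw [Real.sq_sqrt (by positivity), Real.sq_sqrt (by positivity)]
    simp only [ContinuousLinearMap.smulRight_apply, norm_smul, Complex.norm_I, one_mul]
    ring
  rw [this]

/-- Convergence of the components of a 1-form from convergence in norm. -/
theorem tendsto_apply_of_formNorm {V : M → Type*} [∀ x, NormedAddCommGroup (V x)]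
    [∀ x, NormedSpace ℝ (V x)] (g : SurfaceMetric M) (x : M)
    {ψ : TangentSpace 𝓘(ℝ, ℂ) x →L[ℝ] V x} {ψ' : ℕ → TangentSpace 𝓘(ℝ, ℂ) x →L[ℝ] V x}
    (h : Tendsto (fun n ↦ formNorm g x (ψ' n - ψ) ^ 2) atTop (𝓝 0)) (v : ℂ) :
    Tendsto (fun n ↦ ψ' n (coordVec x v x)) atTop (𝓝 (ψ (coordVec x v x))) := by
  have hc := confFactor_pos g (mem_chart_source ℂ x)
  have hk := inv_pos.2 hc
  have key : ∀ w : ℂ, w = 1 ∨ w = Complex.I →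
      Tendsto (fun n ↦ ψ' n (coordVec x w x)) atTop (𝓝 (ψ (coordVec x w x))) := by
    intro w hw
    rw [tendsto_iff_norm_sub_tendsto_zero]
    have h1 : Tendsto (fun n ↦ √(confFactor g x x * formNorm g x (ψ' n - ψ) ^ 2)) atTop (𝓝 0) := by
      have := (h.const_mul (confFactor g x x)).sqrt
      simpa using this
    refine squeeze_zero (fun n ↦ norm_nonneg _) (fun n ↦ Real.le_sqrt_of_sq_le ?_) h1
    rw [formNorm, Real.sq_sqrt (by positivity), ← mul_assoc, mul_inv_cancel₀ hc.ne', one_mul,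
      sub_apply, sub_apply]
    rcases hw with rfl | rfl
    · nlinarith [sq_nonneg ‖ψ' n (coordVec x Complex.I x) - ψ (coordVec x Complex.I x)‖]
    · nlinarith [sq_nonneg ‖ψ' n (coordVec x 1 x) - ψ (coordVec x 1 x)‖]
  rw [coordVec_eq_re_add_im x x v]
  simp only [map_add, map_smul]
  exact ((key 1 (Or.inl rfl)).const_smul _).add ((key Complex.I (Or.inr rfl)).const_smul _)

theorem tendsto_of_distDensity {g : SurfaceMetric M} (hg : IsConformal g) {Φ : Π x, L x}
    {ψ : Π x, TangentSpace 𝓘(ℝ, ℂ) x →L[ℝ] L x} {A : OneForm M} {β : M → ℝ}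
    {s : ℕ → Π x, L x} {a : ℕ → OneForm M} {x : M}
    (h : Tendsto (fun n ↦ distDensity g cov Φ ψ A β (s n) (a n) x) atTop (𝓝 0)) :
    Tendsto (fun n ↦ ‖s n x‖ ^ 2) atTop (𝓝 (‖Φ x‖ ^ 2)) ∧
      Tendsto (fun n ↦ curl g (a n) x) atTop (𝓝 (β x)) ∧
      Tendsto (fun n ↦ formNorm g x (covDeriv (a n) (s n) (cov (s n)) x) ^ 2) atTop
        (𝓝 (formNorm g x (covDeriv A Φ ψ x) ^ 2)) := by
  have h₁ : Tendsto (fun n ↦ ‖s n x - Φ x‖ ^ 2) atTop (𝓝 0) :=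
    squeeze_zero (fun n ↦ by positivity) (fun n ↦ by
      have := sq_nonneg (formNorm g x (cov (s n) x - ψ x))
      have := sq_nonneg (formNorm (V := fun _ ↦ ℝ) g x (a n x - A x))
      have := sq_nonneg (curl g (a n) x - β x)
      rw [distDensity]; linarith) h
  have h₂ : Tendsto (fun n ↦ formNorm g x (cov (s n) x - ψ x) ^ 2) atTop (𝓝 0) :=
    squeeze_zero (fun n ↦ by positivity) (fun n ↦ by
      have := sq_nonneg ‖s n x - Φ x‖
      have := sq_nonneg (formNorm (V := fun _ ↦ ℝ) g x (a n x - A x))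
      have := sq_nonneg (curl g (a n) x - β x)
      rw [distDensity]; linarith) h
  have h₃ : Tendsto (fun n ↦ formNorm (V := fun _ ↦ ℝ) g x (a n x - A x) ^ 2) atTop (𝓝 0) :=
    squeeze_zero (fun n ↦ by positivity) (fun n ↦ by
      have := sq_nonneg ‖s n x - Φ x‖
      have := sq_nonneg (formNorm g x (cov (s n) x - ψ x))
      have := sq_nonneg (curl g (a n) x - β x)
      rw [distDensity]; linarith) h
  have h₄ : Tendsto (fun n ↦ (curl g (a n) x - β x) ^ 2) atTop (𝓝 0) :=
    squeeze_zero (fun n ↦ by positivity) (fun n ↦ by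
      have := sq_nonneg ‖s n x - Φ x‖
      have := sq_nonneg (formNorm g x (cov (s n) x - ψ x))
      have := sq_nonneg (formNorm (V := fun _ ↦ ℝ) g x (a n x - A x))
      rw [distDensity]; linarith) h
  have hs : Tendsto (fun n ↦ s n x) atTop (𝓝 (Φ x)) := by
    rw [tendsto_iff_norm_sub_tendsto_zero]
    simpa [Real.sqrt_sq] using h₁.sqrt
  refine ⟨hs.norm.pow 2, ?_, ?_⟩
  · rw [tendsto_iff_norm_sub_tendsto_zero]
    simpa [Real.sqrt_sq_eq_abs] using h₄.sqrt
  · have hc : ∀ v, Tendsto (fun n ↦ ‖covDeriv (a n) (s n) (cov (s n)) x (coordVec x v x)‖ ^ 2) atTop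
        (𝓝 (‖covDeriv A Φ ψ x (coordVec x v x)‖ ^ 2)) := by
      intro v
      have e₁ := tendsto_apply_of_formNorm g x h₂ v
      have e₂ := tendsto_apply_of_formNorm (V := fun _ ↦ ℝ) g x h₃ v
      exact (e₁.sub (e₂.smul (hs.const_smul Complex.I))).norm.pow 2
    simp only [formNorm_sq_fiber hg (mem_chart_source ℂ x)]
    exact ((hc 1).add (hc Complex.I)).const_mul _

end Approximation

/-! ### Limits in the weighted inequality: smooth to H¹, then ε → 0. -/

section DominatedConvergence

/-- The bound uses a reference value c₀ instead of β, since no integrability of β is known at this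
stage. -/
theorem abs_le_one_add_of_sq_dist {c c₀ β F : ℝ} (h₀ : (c₀ - β) ^ 2 ≤ F) (h : (c - β) ^ 2 ≤ F) :
    |c| ≤ 1 + (8 * F + 2 * c₀ ^ 2) := by
  have h1 : |c| ≤ 1 + c ^ 2 := abs_le.2 ⟨by nlinarith [sq_nonneg (c + 1)],
    by nlinarith [sq_nonneg (c - 1)]⟩
  nlinarith [sq_nonneg (c - β + (c₀ - β)), sq_nonneg (c - c₀ - c₀)]

/-- These bounds are the purpose of the weight: each factor S in the two integrands is absorbed at
the price of ε⁻¹. -/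
theorem weight_bounds {ε S : ℝ} (hε : 0 < ε) (hS : 0 ≤ S) :
    ((1 + ε * S) ^ 2)⁻¹ ≤ 1 ∧ S * (1 + ε * S)⁻¹ ≤ ε⁻¹ ∧ ((1 + ε * S) ^ 2)⁻¹ * S ≤ ε⁻¹ := by
  have h1 : 1 ≤ 1 + ε * S := by nlinarith
  have h2 : S * (1 + ε * S)⁻¹ ≤ ε⁻¹ := by
    rw [← div_eq_mul_inv, div_le_iff₀ (by positivity), mul_add, inv_mul_cancel_left₀ hε.ne']
    have := inv_pos.2 hε
    linarith
  refine ⟨inv_le_one_of_one_le₀ (one_le_pow₀ h1), h2, ?_⟩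
  have h3 : (1 + ε * S)⁻¹ ≤ 1 := inv_le_one_of_one_le₀ h1
  have h4 : 0 ≤ (1 + ε * S)⁻¹ := by positivity
  calc ((1 + ε * S) ^ 2)⁻¹ * S = S * (1 + ε * S)⁻¹ * (1 + ε * S)⁻¹ := by rw [← inv_pow]; ring
    _ ≤ S * (1 + ε * S)⁻¹ * 1 := by gcongr
    _ ≤ ε⁻¹ := by rwa [mul_one]

/-- Dominated convergence for the weighted Bogomolny inequality. -/
theorem integral_weighted_le_of_tendsto {X : Type*} [MeasurableSpace X] {μ : Measure X}
    [IsFiniteMeasure μ] {b ε : ℝ} (hε : 0 < ε) {S' c' D' : ℕ → X → ℝ} {S c D K P Q : X → ℝ}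
    (hS0 : ∀ n x, 0 ≤ S' n x) (hS0' : ∀ x, 0 ≤ S x) (hD0 : ∀ n x, 0 ≤ D' n x)
    (hSm : ∀ n, AEStronglyMeasurable (S' n) μ) (hcm : ∀ n, AEStronglyMeasurable (c' n) μ)
    (hDm : ∀ n, AEStronglyMeasurable (D' n) μ) (hK : Integrable K μ) (hP : Integrable P μ)
    (hQ : Integrable Q μ)
    (hbound : ∀ᵐ x ∂μ, ∀ n, |c' n x| ≤ K x ∧ D' n x ≤ P x + S' n x * Q x)
    (hpos : ∀ᵐ x ∂μ, 0 ≤ P x ∧ 0 ≤ Q x)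
    (hS : ∀ᵐ x ∂μ, Tendsto (fun n ↦ S' n x) atTop (𝓝 (S x)))
    (hc : ∀ᵐ x ∂μ, Tendsto (fun n ↦ c' n x) atTop (𝓝 (c x)))
    (hD : ∀ᵐ x ∂μ, Tendsto (fun n ↦ D' n x) atTop (𝓝 (D x)))
    (h : ∀ n, ∫ x, (b + c' n x) * (S' n x * (1 + ε * S' n x)⁻¹) ∂μ ≤
      ∫ x, ((1 + ε * S' n x) ^ 2)⁻¹ * D' n x ∂μ) :
    ∫ x, (b + c x) * (S x * (1 + ε * S x)⁻¹) ∂μ ≤ ∫ x, ((1 + ε * S x) ^ 2)⁻¹ * D x ∂μ := by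
  have hwm : ∀ n, AEStronglyMeasurable (fun x ↦ (1 + ε * S' n x)⁻¹) μ := fun n ↦
    (((hSm n).const_mul ε).const_add 1).aemeasurable.inv.aestronglyMeasurable
  have hw : ∀ᵐ x ∂μ, Tendsto (fun n ↦ (1 + ε * S' n x)⁻¹) atTop (𝓝 (1 + ε * S x)⁻¹) := by
    filter_upwards [hS] with x hx
    have := hS0' x
    exact ((hx.const_mul ε).const_add 1).inv₀ (by positivity)
  have h1 := tendsto_integral_of_dominated_convergence
    (F := fun n x ↦ (b + c' n x) * (S' n x * (1 + ε * S' n x)⁻¹))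
    (f := fun x ↦ (b + c x) * (S x * (1 + ε * S x)⁻¹))
    (μ := μ) (fun x ↦ (|b| + K x) * ε⁻¹)
    (fun n ↦ ((hcm n).const_add b).mul ((hSm n).mul (hwm n)))
    (((integrable_const _).add hK).mul_const _)
    (fun n ↦ by
      filter_upwards [hbound] with x hx
      have hx0 := hS0 n x
      have hw := (weight_bounds hε hx0).2.1
      rw [norm_mul, Real.norm_eq_abs, Real.norm_of_nonneg (by positivity)]
      refine mul_le_mul ((abs_add_le _ _).trans (by linarith [(hx n).1])) hw (by positivity) ?_
      linarith [abs_nonneg b, (abs_nonneg _).trans (hx n).1])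
    (by filter_upwards [hS, hc, hw] with x hx hx' hx'' using (hx'.const_add b).mul (hx.mul hx''))
  have h2 := tendsto_integral_of_dominated_convergence
    (F := fun n x ↦ ((1 + ε * S' n x) ^ 2)⁻¹ * D' n x)
    (f := fun x ↦ ((1 + ε * S x) ^ 2)⁻¹ * D x)
    -- The factor S' n in the bound P + S' n Q is the only dependence on n, and the squared weight
    -- removes it.
    (μ := μ) (fun x ↦ P x + ε⁻¹ * Q x)
    (fun n ↦ by
      simp only [← inv_pow]
      exact ((hwm n).pow 2).mul (hDm n))
    (hP.add (hQ.const_mul _))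
    (fun n ↦ by
      filter_upwards [hbound, hpos] with x hx hx'
      obtain ⟨hw₁, -, hw₂⟩ := weight_bounds hε (hS0 n x)
      have hD0' := hD0 n x
      have hw₀ : 0 ≤ ((1 + ε * S' n x) ^ 2)⁻¹ := by positivity
      rw [Real.norm_of_nonneg (by positivity)]
      have i₁ := mul_le_mul_of_nonneg_right hw₁ hx'.1
      have i₂ := mul_le_mul_of_nonneg_right hw₂ hx'.2
      have i₃ := mul_le_mul_of_nonneg_left (hx n).2 hw₀
      linarith)
    (by
      filter_upwards [hD, hw] with x hx hx'
      simp only [← inv_pow]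
      exact (hx'.pow 2).mul hx)
  exact le_of_tendsto_of_tendsto' h1 h2 h

/-- `∫ B |Φ|² ≤ ∫ |D_A Φ|²` for fields of finite energy. -/
theorem integral_mul_norm_sq_le {X : Type*} [MeasurableSpace X] {μ : Measure X}
    {B S D : X → ℝ} (hS : ∀ x, 0 ≤ S x) (hD0 : ∀ x, 0 ≤ D x)
    (hSm : AEStronglyMeasurable S μ) (hBm : AEStronglyMeasurable B μ)
    (hBS : Integrable (fun x ↦ B x * S x) μ) (hD : Integrable D μ)
    (h : ∀ ε : ℝ, 0 < ε → ∫ x, B x * (S x * (1 + ε * S x)⁻¹) ∂μ ≤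
      ∫ x, ((1 + ε * S x) ^ 2)⁻¹ * D x ∂μ) :
    ∫ x, B x * S x ∂μ ≤ ∫ x, D x ∂μ := by
  have hε : ∀ n : ℕ, (0 : ℝ) < 1 / ((n : ℝ) + 1) := fun n ↦ by positivity
  have hεl : Tendsto (fun n : ℕ ↦ 1 / ((n : ℝ) + 1)) atTop (𝓝 0) :=
    tendsto_one_div_add_atTop_nhds_zero_nat
  -- On the left |B S| dominates, as the weight is at most 1. On the right no limit is needed: the
  -- weighted integral is at most ∫ D for every ε.
  have hlim := tendsto_integral_of_dominated_convergence
    (F := fun (n : ℕ) x ↦ B x * (S x * (1 + 1 / ((n : ℝ) + 1) * S x)⁻¹))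
    (f := fun x ↦ B x * S x) (μ := μ) (fun x ↦ ‖B x * S x‖)
    (fun n ↦ hBm.mul (hSm.mul
      (((hSm.const_mul _).const_add 1).aemeasurable.inv.aestronglyMeasurable)))
    hBS.norm
    (fun n ↦ Eventually.of_forall fun x ↦ by
      have h1 : (1 : ℝ) ≤ 1 + 1 / ((n : ℝ) + 1) * S x := by
        have := mul_nonneg (hε n).le (hS x)
        linarith
      rw [← mul_assoc, norm_mul (B x * S x)]
      refine mul_le_of_le_one_right (norm_nonneg _) ?_
      rw [norm_inv, Real.norm_of_nonneg (by linarith)]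
      exact inv_le_one_of_one_le₀ h1)
    (Eventually.of_forall fun x ↦ by
      have h1 : Tendsto (fun n : ℕ ↦ (1 + 1 / ((n : ℝ) + 1) * S x)⁻¹) atTop (𝓝 1) := by
        have := ((hεl.mul_const (S x)).const_add 1).inv₀ (by simp)
        simpa using this
      simpa using (h1.const_mul (S x)).const_mul (B x))
  refine le_of_tendsto' hlim fun n ↦ (h _ (hε n)).trans ?_
  refine integral_mono_of_nonneg (Eventually.of_forall fun x ↦ ?_) hD
    (Eventually.of_forall fun x ↦ ?_)
  · have := hD0 x
    positivity
  · have h1 : (1 : ℝ) ≤ 1 + 1 / ((n : ℝ) + 1) * S x := by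
      have := mul_nonneg (hε n).le (hS x)
      linarith
    exact mul_le_of_le_one_left (hD0 x) (inv_le_one_of_one_le₀ (one_le_pow₀ h1))

end DominatedConvergence

/-! ### The weighted inequality and the total flux for H¹ fields. -/

section Limit

variable {M : Type*} [TopologicalSpace M] [ChartedSpace ℂ M] [IsManifold 𝓘(ℝ, ℂ) ∞ M]
  {L : M → Type*} [∀ x, NormedAddCommGroup (L x)] [∀ x, InnerProductSpace ℂ (L x)]
  [TopologicalSpace (TotalSpace ℂ L)] [FiberBundle ℂ L] [VectorBundle ℂ ℂ L]
  [VectorBundle ℝ ℂ L] {cov : CovariantDerivative 𝓘(ℝ, ℂ) ℂ L}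

theorem OneForm.isSmooth_zero : OneForm.IsSmooth (0 : OneForm M) := fun _ _ ↦ contDiffOn_const

theorem covDeriv_zero_left (Φ : Π x, L x) (ψ : Π x, TangentSpace 𝓘(ℝ, ℂ) x →L[ℝ] L x) (x : M) :
    covDeriv 0 Φ ψ x = ψ x := by
  ext v
  rw [covDeriv_apply]
  simp

/-- All majorants are built from F and the approximant of index 0, which is smooth and hence
contributes integrable terms on a compact surface. Only ‖s n x‖² still varies with n. -/
theorem bounds_of_distDensity {g : SurfaceMetric M} [IsManifold 𝓘(ℂ, ℂ) ω M] {Φ : Π x, L x}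
    {ψ : Π x, TangentSpace 𝓘(ℝ, ℂ) x →L[ℝ] L x} {A : OneForm M} {β : M → ℝ}
    {s : ℕ → Π x, L x} {a : ℕ → OneForm M} {x : M} {F : ℝ}
    (h : ∀ n, distDensity g cov Φ ψ A β (s n) (a n) x ≤ F) (n : ℕ) :
    |curl g (a n) x| ≤ 1 + (8 * F + 2 * curl g (a 0) x ^ 2) ∧
      formNorm g x (covDeriv (a n) (s n) (cov (s n)) x) ^ 2 ≤
        2 * (8 * F + 2 * formNorm g x (cov (s 0) x) ^ 2) + ‖s n x‖ ^ 2 *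
          (2 * (8 * F + 2 * formNorm (V := fun _ ↦ ℝ) g x (a 0 x) ^ 2)) := by
  have h' : ∀ m, formNorm g x (cov (s m) x - ψ x) ^ 2 ≤ F ∧
      formNorm (V := fun _ ↦ ℝ) g x (a m x - A x) ^ 2 ≤ F ∧
      (curl g (a m) x - β x) ^ 2 ≤ F := by
    intro m
    have h1 := h m
    have e₁ := sq_nonneg ‖s m x - Φ x‖
    have e₂ := sq_nonneg (formNorm g x (cov (s m) x - ψ x))
    have e₃ := sq_nonneg (formNorm (V := fun _ ↦ ℝ) g x (a m x - A x))
    have e₄ := sq_nonneg (curl g (a m) x - β x)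
    rw [distDensity] at h1
    refine ⟨?_, ?_, ?_⟩ <;> linarith
  refine ⟨abs_le_one_add_of_sq_dist (h' 0).2.2 (h' n).2.2, ?_⟩
  have e₁ := formNorm_sq_le_of_dist g x (h' 0).1 (h' n).1
  have e₂ := formNorm_sq_le_of_dist (V := fun _ ↦ ℝ) g x (h' 0).2.1 (h' n).2.1
  have e₃ := formNorm_sq_covDeriv_le g (a n) (s n) (cov (s n)) x
  have e₄ := mul_le_mul_of_nonneg_left e₂ (sq_nonneg ‖s n x‖)
  linarith

variable [T2Space M] [ContMDiffVectorBundle ∞ ℂ L 𝓘(ℝ, ℂ)]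
  [IsManifold 𝓘(ℂ, ℂ) ω M] [CompactSpace M] [MeasurableSpace M] [BorelSpace M]

/-- Membership in H¹ only makes certain differences measurable; measurability of these densities
comes from their being almost everywhere limits of continuous ones. -/
theorem h1_measurable (hL : IsSmoothHermitian L) {g : SurfaceMetric M} (hg : IsConformal g)
    (hcov : IsUnitaryConnection cov)
    {Φ : Π x, L x} {ψ : Π x, TangentSpace 𝓘(ℝ, ℂ) x →L[ℝ] L x} {A : OneForm M} {β : M → ℝ}
    (hΦ : IsH1Section g cov Φ ψ) (hA : IsH1OneForm g A β) :
    AEStronglyMeasurable (fun x ↦ ‖Φ x‖ ^ 2) (areaMeasure g) ∧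
      AEStronglyMeasurable (fun x ↦ formNorm g x (covDeriv A Φ ψ x) ^ 2) (areaMeasure g) := by
  obtain ⟨s, a, F, hs, ha, hF, hae⟩ := exists_dominated_approximation hΦ hA
  exact ⟨aestronglyMeasurable_of_tendsto_ae atTop
      (fun n ↦ (hL.contMDiff_norm_sq (hs n)).continuous.aestronglyMeasurable)
      (hae.mono fun x hx ↦ (tendsto_of_distDensity hg hx.2).1),
    aestronglyMeasurable_of_tendsto_ae atTop
      (fun n ↦ (continuous_formNorm_sq_covDeriv hL hg hcov (ha n) (hs n)).aestronglyMeasurable)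
      (hae.mono fun x hx ↦ (tendsto_of_distDensity hg hx.2).2.2)⟩

theorem integrable_one_add_curl_sq {g : SurfaceMetric M} (hg : IsConformal g) {F : M → ℝ}
    (hF : Integrable F (areaMeasure g)) {a : OneForm M} (ha : a.IsSmooth) :
    Integrable (fun x ↦ 1 + (8 * F x + 2 * curl g a x ^ 2)) (areaMeasure g) := by
  have hfin := isFiniteMeasure_areaMeasure hg
  exact (integrable_const 1).add ((hF.const_mul 8).add
    (integrable_of_continuous hg (((continuous_curl hg ha).pow 2).const_mul 2)))

/-- The weak exterior derivative of an `H¹` form is integrable with vanishing integral. -/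
theorem integral_weak_curl {g : SurfaceMetric M} (hg : IsConformal g)
    {Φ : Π x, L x} {ψ : Π x, TangentSpace 𝓘(ℝ, ℂ) x →L[ℝ] L x} {A : OneForm M} {β : M → ℝ}
    (hΦ : IsH1Section g cov Φ ψ) (hA : IsH1OneForm g A β) :
    Integrable β (areaMeasure g) ∧ ∫ x, β x ∂(areaMeasure g) = 0 := by
  obtain ⟨s, a, F, hs, ha, hF, hae⟩ := exists_dominated_approximation hΦ hA
  have hK := integrable_one_add_curl_sq hg hF (ha 0)
  have hcm := fun n ↦ (continuous_curl hg (ha n)).aestronglyMeasurable (μ := areaMeasure g)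
  have hlim := hae.mono fun x hx ↦ (tendsto_of_distDensity hg hx.2).2.1
  have hbound := hae.mono fun x hx n ↦ (bounds_of_distDensity hx.1 n).1
  refine ⟨hK.mono' (aestronglyMeasurable_of_tendsto_ae atTop hcm hlim) ?_, ?_⟩
  · filter_upwards [hlim, hbound] with x hx hx'
    exact le_of_tendsto' hx.norm hx'
  · have h := tendsto_integral_of_dominated_convergence _ hcm hK
      (fun n ↦ hbound.mono fun x hx ↦ hx n) hlim
    simp only [integral_curl hg (ha _)] at h
    exact tendsto_nhds_unique h tendsto_const_nhds

/-- The weighted Bogomolny inequality for `H¹` fields. -/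
theorem h1_weighted_le (hL : IsSmoothHermitian L) {g : SurfaceMetric M} (hg : IsConformal g)
    (hcov : IsUnitaryConnection cov) {b : ℝ} (hb : HasCurvature g cov fun _ ↦ b)
    {Φ : Π x, L x} {ψ : Π x, TangentSpace 𝓘(ℝ, ℂ) x →L[ℝ] L x} {A : OneForm M} {β : M → ℝ}
    (hΦ : IsH1Section g cov Φ ψ) (hA : IsH1OneForm g A β) {ε : ℝ} (hε : 0 < ε) :
    ∫ x, (b + β x) * (‖Φ x‖ ^ 2 * (1 + ε * ‖Φ x‖ ^ 2)⁻¹) ∂(areaMeasure g) ≤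
      ∫ x, ((1 + ε * ‖Φ x‖ ^ 2) ^ 2)⁻¹ * formNorm g x (covDeriv A Φ ψ x) ^ 2
        ∂(areaMeasure g) := by
  have hfin := isFiniteMeasure_areaMeasure hg
  obtain ⟨s, a, F, hs, ha, hF, hae⟩ := exists_dominated_approximation hΦ hA
  have hc0 : Continuous fun x ↦ formNorm g x (cov (s 0) x) ^ 2 := by
    simpa only [covDeriv_zero_left] using
      continuous_formNorm_sq_covDeriv hL hg hcov OneForm.isSmooth_zero (hs 0)
  have hP := ((hF.const_mul 8).add (integrable_of_continuous hg (hc0.const_mul 2))).const_mul 2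
  have hQ := ((hF.const_mul 8).add (integrable_of_continuous hg
    ((continuous_formNorm_sq hg (ha 0)).const_mul 2))).const_mul 2
  exact integral_weighted_le_of_tendsto hε (S' := fun n x ↦ ‖s n x‖ ^ 2)
    (D' := fun n x ↦ formNorm g x (covDeriv (a n) (s n) (cov (s n)) x) ^ 2)
    (c' := fun n ↦ curl g (a n)) (fun _ _ ↦ sq_nonneg _) (fun _ ↦ sq_nonneg _)
    (fun _ _ ↦ sq_nonneg _)
    (fun n ↦ (hL.contMDiff_norm_sq (hs n)).continuous.aestronglyMeasurable)
    (fun n ↦ (continuous_curl hg (ha n)).aestronglyMeasurable)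
    (fun n ↦ (continuous_formNorm_sq_covDeriv hL hg hcov (ha n) (hs n)).aestronglyMeasurable)
    (integrable_one_add_curl_sq hg hF (ha 0)) hP hQ
    (hae.mono fun x hx n ↦ bounds_of_distDensity hx.1 n)
    (hae.mono fun x hx ↦ by
      have h0 : 0 ≤ F x := le_trans (by rw [distDensity]; positivity) (hx.1 0)
      simp only [Pi.add_apply]
      constructor <;> positivity)
    (hae.mono fun x hx ↦ (tendsto_of_distDensity hg hx.2).1)
    (hae.mono fun x hx ↦ (tendsto_of_distDensity hg hx.2).2.1)
    (hae.mono fun x hx ↦ (tendsto_of_distDensity hg hx.2).2.2)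
    fun n ↦ integral_weighted_le hL hg hcov hb (ha n) (hs n) hε.le

end Limit

/-! ### The energy lower bound and its attainment at Φ = 0. -/

section EnergyBound

variable {M : Type*} [TopologicalSpace M] [ChartedSpace ℂ M] [IsManifold 𝓘(ℝ, ℂ) ∞ M]
  {L : M → Type*} [∀ x, NormedAddCommGroup (L x)] [∀ x, InnerProductSpace ℂ (L x)]
  [TopologicalSpace (TotalSpace ℂ L)] [FiberBundle ℂ L] [VectorBundle ℂ ℂ L]
  [VectorBundle ℝ ℂ L] {cov : CovariantDerivative 𝓘(ℝ, ℂ) ℂ L}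

/-- An integrable lower bound for a nonnegative function passes to the lower integral. -/
theorem ofReal_le_lintegral_of_forall_integrable {X : Type*} [MeasurableSpace X] {μ : Measure X}
    {f : X → ℝ} {c : ℝ} (hf0 : ∀ x, 0 ≤ f x) (hfm : AEStronglyMeasurable f μ)
    (h : Integrable f μ → c ≤ ∫ x, f x ∂μ) :
    ENNReal.ofReal c ≤ ∫⁻ x, ENNReal.ofReal (f x) ∂μ := by
  by_cases hi : Integrable f μ
  · rw [← ofReal_integral_eq_lintegral_ofReal hi (Eventually.of_forall hf0)]
    exact ENNReal.ofReal_le_ofReal (h hi)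
  · have : ∫⁻ x, ENNReal.ofReal (f x) ∂μ = ⊤ := by
      by_contra hne
      exact hi ((lintegral_ofReal_ne_top_iff_integrable hfm (Eventually.of_forall hf0)).1 hne)
    rw [this]
    exact le_top

/-- The lower bound of the energy, in terms of the magnetic field `B`, the squared norm `S` of
the section, and the squared norm `D` of its covariant derivative. -/
theorem integral_density_ge {X : Type*} [MeasurableSpace X] {μ : Measure X} [IsFiniteMeasure μ]
    {B S D : X → ℝ} {t : ℝ} (ht : 0 ≤ t) (hS : ∀ x, 0 ≤ S x) (hD : ∀ x, 0 ≤ D x)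
    (hSm : AEStronglyMeasurable S μ) (hDm : AEStronglyMeasurable D μ) (hB : Integrable B μ)
    (h : ∀ ε : ℝ, 0 < ε → ∫ x, B x * (S x * (1 + ε * S x)⁻¹) ∂μ ≤
      ∫ x, ((1 + ε * S x) ^ 2)⁻¹ * D x ∂μ)
    (hi : Integrable (fun x ↦ D x + B x ^ 2 + (1 - S x) ^ 2 / 4) μ) :
    (1 + 2 * t) * ∫ x, B x ∂μ - (t + t ^ 2) * μ.real Set.univ ≤
      ∫ x, D x + B x ^ 2 + (1 - S x) ^ 2 / 4 ∂μ := by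
  have hBm := hB.aestronglyMeasurable
  have hD' : Integrable D μ := hi.mono' hDm (Eventually.of_forall fun x ↦ by
    rw [Real.norm_of_nonneg (hD x)]
    nlinarith [sq_nonneg (B x), sq_nonneg (1 - S x)])
  have hB2 : Integrable (fun x ↦ B x ^ 2) μ := hi.mono' (hBm.pow 2)
    (Eventually.of_forall fun x ↦ by
      rw [Real.norm_of_nonneg (sq_nonneg _)]
      nlinarith [hD x, sq_nonneg (1 - S x)])
  have hS2 : Integrable (fun x ↦ (1 - S x) ^ 2 / 4) μ := hi.mono'
    ((((aestronglyMeasurable_const (b := (1 : ℝ))).sub hSm).pow 2).mul_const (1 / 4) |>.congr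
      (Eventually.of_forall fun x ↦ by simp [div_eq_mul_inv]))
    (Eventually.of_forall fun x ↦ by
      rw [Real.norm_of_nonneg (by positivity)]
      nlinarith [hD x, sq_nonneg (B x)])
  -- The majorant is B² + 2(1 - S)² + 2: indeed |B S| ≤ (B² + S²)/2, and 2(1 - S)² + 2 - S²/2 = S²/2
  -- + (S - 2)².
  have hBS : Integrable (fun x ↦ B x * S x) μ :=
    ((hB2.add (hS2.const_mul 8)).add (integrable_const 2)).mono' (hBm.mul hSm)
      (Eventually.of_forall fun x ↦ by
        rw [Real.norm_eq_abs]
        simp only [Pi.add_apply]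
        refine abs_le.2 ⟨?_, ?_⟩ <;>
          nlinarith [sq_nonneg (B x + S x), sq_nonneg (B x - S x), sq_nonneg (S x - 2)])
  have hBS2 : Integrable (fun x ↦ B x ^ 2 + (1 - S x) ^ 2 / 4) μ := hB2.add hS2
  have hle := integral_mul_norm_sq_le hS hD hSm hBm hBS hD' h
  have hmono : ∫ x, (1 + 2 * t) * B x - (t + t ^ 2) ∂μ ≤
      ∫ x, B x * S x + (B x ^ 2 + (1 - S x) ^ 2 / 4) ∂μ := by
    refine integral_mono ((hB.const_mul _).sub (integrable_const _)) (hBS.add hBS2)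
      fun x ↦ ?_
    have := hS x
    change (1 + 2 * t) * B x - (t + t ^ 2) ≤ B x * S x + (B x ^ 2 + (1 - S x) ^ 2 / 4)
    -- Right side minus left side is exactly (B - (1 - S)/2 - t)² + t S; this is where t ≥ 0 enters.
    nlinarith [sq_nonneg (B x - (1 - S x) / 2 - t), mul_nonneg ht this]
  rw [integral_sub (hB.const_mul _) (integrable_const _), integral_const_mul, integral_const,
    integral_add hBS hBS2, smul_eq_mul] at hmono
  have hsplit : ∫ x, D x + B x ^ 2 + (1 - S x) ^ 2 / 4 ∂μ =
      ∫ x, D x ∂μ + ∫ x, B x ^ 2 + (1 - S x) ^ 2 / 4 ∂μ := by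
    rw [← integral_add hD' hBS2]
    exact integral_congr_ae (Eventually.of_forall fun x ↦ by ring)
  rw [hsplit]
  linarith

theorem isSmoothSection_zero [ContMDiffVectorBundle ∞ ℂ L 𝓘(ℝ, ℂ)] :
    IsSmoothSection (fun x ↦ (0 : L x)) :=
  contMDiff_zeroSection ℝ L

theorem curl_zero (g : SurfaceMetric M) : curl g (0 : OneForm M) = 0 := by
  funext x
  have h : ∀ v, coeff (0 : OneForm M) x v = fun _ ↦ 0 := fun v ↦ rfl
  simp [curl, h]

theorem divg_zero (g : SurfaceMetric M) : divg g (0 : OneForm M) = 0 := by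
  funext x
  have h : ∀ v, coeff (0 : OneForm M) x v = fun _ ↦ 0 := fun v ↦ rfl
  simp [divg, h]

variable [MeasurableSpace M]

theorem tendstoZeroL2_of_eq_zero (g : SurfaceMetric M) {f : ℕ → M → ℝ} (h : ∀ n x, f n x = 0) :
    TendstoZeroL2 g f := by
  obtain rfl : f = fun _ _ ↦ 0 := funext fun n ↦ funext (h n)
  exact ⟨fun n ↦ aemeasurable_const, by simp⟩

theorem isH1OneForm_zero (g : SurfaceMetric M) : IsH1OneForm g 0 0 :=
  ⟨fun _ ↦ 0, 0, fun _ ↦ OneForm.isSmooth_zero,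
    tendstoZeroL2_of_eq_zero g fun n x ↦ by simp [formNorm],
    tendstoZeroL2_of_eq_zero g fun n x ↦ by simp [curl_zero],
    tendstoZeroL2_of_eq_zero g fun n x ↦ by simp [divg_zero]⟩

theorem isH1Section_zero [ContMDiffVectorBundle ∞ ℂ L 𝓘(ℝ, ℂ)] (g : SurfaceMetric M)
    (cov : CovariantDerivative 𝓘(ℝ, ℂ) ℂ L) : IsH1Section g cov (fun x ↦ (0 : L x)) 0 := by
  have h0 : cov (fun x ↦ (0 : L x)) = 0 := cov.zero
  exact ⟨fun _ x ↦ 0, fun _ ↦ isSmoothSection_zero,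
    tendstoZeroL2_of_eq_zero g fun n x ↦ by simp,
    tendstoZeroL2_of_eq_zero g fun n x ↦ by simp [formNorm, h0]⟩

theorem energyDensity_zero (g : SurfaceMetric M) (A : OneForm M) (B : M → ℝ) (x : M) :
    energyDensity g A (fun x ↦ (0 : L x)) 0 B x = B x ^ 2 + 1 / 4 := by
  have : covDeriv A (fun x ↦ (0 : L x)) 0 x = 0 := by
    ext v
    simp [covDeriv_apply]
  simp [energyDensity, this, formNorm]

variable [T2Space M] [ContMDiffVectorBundle ∞ ℂ L 𝓘(ℝ, ℂ)]
  [IsManifold 𝓘(ℂ, ℂ) ω M] [CompactSpace M] [BorelSpace M]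

/-- Zero area would give 2πN = 0 by the degree identity, contradicting the strict inequality. -/
theorem area_pos (hL : IsSmoothHermitian L) {g : SurfaceMetric M} (hg : IsConformal g)
    (hcov : IsUnitaryConnection cov) {b : ℝ} (hb : HasCurvature g cov fun _ ↦ b) {N : ℕ}
    (hN : HasDegree g L N) (harea : area g < 4 * Real.pi * N) : 0 < area g := by
  have h := curvature_mul_area hL hg hcov hb hN
  refine lt_of_le_of_ne ENNReal.toReal_nonneg fun h0 ↦ ?_
  rw [← h0, mul_zero, Int.cast_natCast] at h
  rw [← h0] at harea
  linarith

/-- The bound is proved for every admissible pair of weak derivatives, so it passes to the infimum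
without appeal to their uniqueness. -/
theorem le_energy (hL : IsSmoothHermitian L) {g : SurfaceMetric M} (hg : IsConformal g)
    (hcov : IsUnitaryConnection cov) {b : ℝ} (hb : HasCurvature g cov fun _ ↦ b) {N : ℕ}
    (hN : HasDegree g L N) (harea : area g < 4 * Real.pi * N) (A : OneForm M) (Φ : Π x, L x) :
    ENNReal.ofReal (Real.pi * N + (4 * Real.pi * N - area g) ^ 2 / (8 * area g)) ≤
      energy g cov b A Φ := by
  have hfin := isFiniteMeasure_areaMeasure hg
  have hpos := area_pos hL hg hcov hb hN harea
  have hbN : b * area g = 2 * Real.pi * N := by simpa using curvature_mul_area hL hg hcov hb hN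
  refine le_iInf fun ψ ↦ le_iInf fun β ↦ le_iInf fun hΦ ↦ le_iInf fun hA ↦ ?_
  obtain ⟨hβ, hβ0⟩ := integral_weak_curl hg hΦ hA
  obtain ⟨hSm, hDm⟩ := h1_measurable hL hg hcov hΦ hA
  have hB : Integrable (fun x ↦ b + β x) (areaMeasure g) := (integrable_const b).add hβ
  have hBi : ∫ x, b + β x ∂(areaMeasure g) = 2 * Real.pi * N := by
    rw [integral_add (integrable_const b) hβ, hβ0, integral_const, smul_eq_mul, add_zero,
      mul_comm, ← hbN]
    rfl
  have hkey : ENNReal.ofReal (2 * Real.pi * N + (4 * Real.pi * N - area g) ^ 2 / (4 * area g)) ≤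
      ∫⁻ x, ENNReal.ofReal (energyDensity g A Φ ψ (fun y ↦ b + β y) x) ∂(areaMeasure g) := by
    refine ofReal_le_lintegral_of_forall_integrable
      (fun x ↦ by rw [energyDensity]; positivity) ?_ fun hi ↦ ?_
    · refine ((hDm.add (hB.aestronglyMeasurable.pow 2)).add
        (((aestronglyMeasurable_const (b := (1 : ℝ))).sub hSm).pow 2 |>.mul_const 4⁻¹)).congr ?_
      exact Eventually.of_forall fun x ↦ by simp [energyDensity, div_eq_mul_inv]
    -- This t maximises (1 + 2t) 2πN - (t + t²)|Σ|; it equals b - 1/2, the value of B - (1 - |Φ|²)/2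
    -- at the minimiser.
    · have ht : 0 ≤ (4 * Real.pi * N - area g) / (2 * area g) :=
        div_nonneg (by linarith) (by linarith)
      have h := integral_density_ge ht (fun x ↦ sq_nonneg ‖Φ x‖) (fun x ↦ sq_nonneg _) hSm hDm hB
        (fun ε hε ↦ h1_weighted_le hL hg hcov hb hΦ hA hε) hi
      refine le_trans (le_of_eq ?_) h
      rw [hBi]
      change _ = _ - _ * area g
      field_simp
      ring
  calc _ = 2⁻¹ * ENNReal.ofReal
        (2 * Real.pi * N + (4 * Real.pi * N - area g) ^ 2 / (4 * area g)) := by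
        rw [← ENNReal.ofReal_ofNat 2, ← ENNReal.ofReal_inv_of_pos two_pos,
          ← ENNReal.ofReal_mul (by norm_num)]
        congr 1
        field_simp
        ring
    _ ≤ _ := mul_le_mul_right hkey _

theorem energy_zero_section (hL : IsSmoothHermitian L) {g : SurfaceMetric M} (hg : IsConformal g)
    (hcov : IsUnitaryConnection cov) {b : ℝ} (hb : HasCurvature g cov fun _ ↦ b) {N : ℕ}
    (hN : HasDegree g L N) (harea : area g < 4 * Real.pi * N) {A : OneForm M}
    (hA : IsConstantCurvature g b A) :
    energy g cov b A (fun x ↦ (0 : L x)) =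
      ENNReal.ofReal (Real.pi * N + (4 * Real.pi * N - area g) ^ 2 / (8 * area g)) := by
  have hfin := isFiniteMeasure_areaMeasure hg
  have hpos := area_pos hL hg hcov hb hN harea
  have hbN : b * area g = 2 * Real.pi * N := by simpa using curvature_mul_area hL hg hcov hb hN
  refine le_antisymm ?_ (le_energy hL hg hcov hb hN harea A _)
  obtain ⟨β, c, hβ, hc⟩ := hA
  have h0 := isH1Section_zero (L := L) g cov
  obtain ⟨hβi, hβ0⟩ := integral_weak_curl hg h0 hβ
  -- The weak curl has zero mean, so the constant c carries the whole flux 2πN.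
  have hcN : c * area g = 2 * Real.pi * N := by
    have h := integral_congr_ae hc
    rw [integral_add (integrable_const b) hβi, hβ0, integral_const, integral_const, smul_eq_mul,
      smul_eq_mul, add_zero] at h
    change area g * b = area g * c at h
    rw [← hbN, mul_comm c, ← h, mul_comm]
  rw [energy]
  -- Only the upper bound remains, so one admissible pair suffices: ∇Φ = 0 and the given β, with
  -- energy (c² + 1/4)|Σ|/2.
  refine iInf_le_of_le 0 <| iInf_le_of_le β <| iInf_le_of_le h0 <| iInf_le_of_le hβ <| le_of_eq ?_
  have hlin : ∫⁻ x, ENNReal.ofReal (energyDensity g A (fun x ↦ (0 : L x)) 0 (fun y ↦ b + β y) x)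
      ∂(areaMeasure g) = ENNReal.ofReal ((c ^ 2 + 1 / 4) * area g) := by
    rw [ENNReal.ofReal_mul (by positivity), area, ENNReal.ofReal_toReal (measure_ne_top _ _),
      ← lintegral_const]
    refine lintegral_congr_ae ?_
    filter_upwards [hc] with x hx
    rw [energyDensity_zero, hx]
  rw [hlin, ← ENNReal.ofReal_ofNat 2, ← ENNReal.ofReal_inv_of_pos two_pos,
    ← ENNReal.ofReal_mul (by norm_num)]
  congr 1
  obtain rfl : c = 2 * Real.pi * N / area g := by rw [← hcN]; field_simp
  field_simp
  ring

end EnergyBound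

end GinzburgLandau

end

/-! ### The main theorem. -/

theorem lemma3p5
    {M : Type*} [TopologicalSpace M] [T2Space M] [CompactSpace M] [ConnectedSpace M]
    [ChartedSpace ℂ M] [IsManifold 𝓘(ℂ, ℂ) ω M] [IsManifold 𝓘(ℝ, ℂ) ∞ M]
    [MeasurableSpace M] [BorelSpace M]
    (g : GinzburgLandau.SurfaceMetric M) (hg : GinzburgLandau.IsConformal g)
    {L : M → Type*} [∀ x, NormedAddCommGroup (L x)] [∀ x, InnerProductSpace ℂ (L x)]
    [TopologicalSpace (TotalSpace ℂ L)] [FiberBundle ℂ L] [VectorBundle ℂ ℂ L]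
    [VectorBundle ℝ ℂ L] [ContMDiffVectorBundle ∞ ℂ L 𝓘(ℝ, ℂ)]
    (hL : GinzburgLandau.IsSmoothHermitian L)
    (N : ℕ) (hN : GinzburgLandau.HasDegree g L N)
    (cov : CovariantDerivative 𝓘(ℝ, ℂ) ℂ L) (hcov : GinzburgLandau.IsUnitaryConnection cov)
    (b : ℝ) (hb : GinzburgLandau.HasCurvature g cov (fun _ ↦ b))
    (harea : GinzburgLandau.area g < 4 * Real.pi * N) :
    IsLeast
      ((fun p : GinzburgLandau.OneForm M × (Π x, L x) ↦
          GinzburgLandau.energy g cov b p.1 p.2) ''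
        (GinzburgLandau.H1OneForm g ×ˢ GinzburgLandau.H1Section g cov))
      (ENNReal.ofReal (Real.pi * N +
        (4 * Real.pi * N - GinzburgLandau.area g) ^ 2 / (8 * GinzburgLandau.area g))) ∧
    (∃ A ∈ GinzburgLandau.H1OneForm g, GinzburgLandau.IsConstantCurvature g b A) ∧
    ∀ A ∈ GinzburgLandau.H1OneForm g, GinzburgLandau.IsConstantCurvature g b A →
      GinzburgLandau.energy g cov b A (fun x ↦ (0 : L x)) =
        ENNReal.ofReal (Real.pi * N +
          (4 * Real.pi * N - GinzburgLandau.area g) ^ 2 / (8 * GinzburgLandau.area g)) := by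
  have h0 := GinzburgLandau.isH1OneForm_zero g
  -- The reference connection itself has constant curvature, so A = 0 is a witness.
  have hconst : GinzburgLandau.IsConstantCurvature g b 0 :=
    ⟨0, b, h0, Eventually.of_forall fun x ↦ by simp⟩
  refine ⟨⟨?_, ?_⟩, ⟨0, ⟨0, h0⟩, hconst⟩, fun A _ hA ↦
    GinzburgLandau.energy_zero_section hL hg hcov hb hN harea hA⟩
  · exact ⟨(0, fun x ↦ 0), ⟨⟨0, h0⟩, ⟨0, GinzburgLandau.isH1Section_zero g cov⟩⟩,
      GinzburgLandau.energy_zero_section hL hg hcov hb hN harea hconst⟩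
  · rintro _ ⟨⟨A, Φ⟩, -, rfl⟩
    exact GinzburgLandau.le_energy hL hg hcov hb hN harea A Φ
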